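/- **Setting.** Let $A\in\mathbb R^{n\times n}$, $B\in\mathbb R^{n\times q}$, $C\in\mathbb R^{q\times n}$ be such that the nominal closed loop $\dot x=(A+BC)x$ is exponentially stable. Put $$F=\begin{pmatrix}F_{11}&F_{12}\\F_{21}&F_{22}\end{pmatrix}=\begin{pmatrix}A+BC&B\\-C(A+BC)&-CB\end{pmatrix}.$$ (S1) Let $\gamma_x>0$, let $Q=Q^T>0$, and let $V(x,e)=\tfrac12\,(x,e)^TP\,(x,e)$, where $P=\begin{pmatrix}P_1&0\\0&P_2\end{pmatrix}$ is symmetric positive definite, $F_{11}^TP_1+P_1F_{11}\le -Q$ and $\gamma_xI<Q$. (S2) Let $\gamma_e>0$ and $$\overline{\mathcal C}=\{(x,e): \langle\nabla V(x,e),F(x,e)\rangle\le-\gamma_x|x|^2\text{ and }|e|\le\gamma_e|x|\},$$ $$\overline{\mathcal D}=\{(x,e): \langle\nabla V(x,e),F(x,e)\rangle\ge-\gamma_x|x|^2\text{ or }|e|\ge\gamma_e|x|\}.$$ For $0<\Delta<\rho$ consider the hybrid system with state $(x,e,\tau)\in\mathbb R^n\times\mathbb R^q\times\mathbb R$ that flows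 according to $$\dot x=F_{11}x+F_{12}e,\quad \dot e=F_{21}x+F_{22}e,\quad \dot\tau=1-\mathrm{dz}(\tau/\rho)$$ on the set where $\tau\ge0$ and ($(x,e)\in\overline{\mathcal C}$ or $\tau\le\Delta$), and jumps according to $$x^+=x,\quad e^+=0,\quad \tau^+=0$$ on the set where $(x,e)\in\overline{\mathcal D}$ and $\tau\ge\Delta$. Here $\mathrm{dz}(s)=0$ for $|s|\le1$ and $\mathrm{dz}(s)=\mathrm{sgn}(s)(|s|-1)$ for $|s|\ge1$. Solutions are hybrid arcs $(t,j)\mapsto X(t,j)$ on hybrid time domains, locally absolutely continuous in $t$, with initial point in the union of the closure of the flow set and the jump set. For a compact set $\mathcal A$, let $|X|_{\mathcal A}$ denote the Euclidean distance from $X$ to $\mathcal A$. The basin of attraction of $\mathcal A$ is the set of points from which every solution is bounded and every complete solution (one with unbounded domain) satisfies $|X(t,j)|_{\mathcal A}\to0$ as $t+j\to\infty$. - $\mathcal A$ is *globally asymptotically stable* if: for every $\varepsilon>0$ there is $\delta>0$ such that every solution with $|X(0,0)|_{\mathcal A}\le\delta$ satisfies $|X(t,j)|_{\mathcal A}\le\varepsilon$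 on its whole domain; every maximal solution is complete; there is $\delta>0$ such that every solution with $|X(0,0)|_{\mathcal A}\le\delta$ is bounded and, if complete, satisfies $|X(t,j)|_{\mathcal A}\to0$ as $t+j\to\infty$; and the basin of attraction is the whole space. - $\mathcal A$ is *globally exponentially stable* if there are $k,\gamma>0$ such that every solution satisfies $|X(t,j)|_{\mathcal A}\le k\,e^{-\gamma(t+j)}|X(0,0)|_{\mathcal A}$ on its domain, and the basin of attraction is the whole space. **Theorem.** There is $\rho_0>0$ such that for all $0<\Delta<\rho<\rho_0$ the compact set $\mathcal A=\{0\}\times\{0\}\times[0,2\rho]\subset\mathbb R^n\times\mathbb R^q\times\mathbb R$ is globally asymptotically stable for this hybrid system. If moreover $B$ has full column rank, then $\mathcal A$ is globally exponentially stable. -/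

import Mathlib

open Matrix
open scoped Gradient

noncomputable section

namespace TLazy

/-! ### Hybrid time domains, hybrid arcs and hybrid systems -/

/-- A hybrid time domain: a union of infinitely many intervals `[t_j, t_{j+1}] × {j}` with
`0 = t_0 ≤ t_1 ≤ …`, or of finitely many of them, the last one being possibly of the form
`[t_J, T] × {J}`, `[t_J, T) × {J}` or `[t_J, ∞) × {J}`. -/
def IsHybridTimeDomain (E : Set (ℝ × ℕ)) : Prop :=
  ∃ t : ℕ → ℝ, t 0 = 0 ∧ Monotone t ∧
    (E = {p | p.1 ∈ Set.Icc (t p.2) (t (p.2 + 1))} ∨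
      ∃ (J : ℕ) (I : Set ℝ),
        ((∃ T, t J ≤ T ∧ I = Set.Icc (t J) T) ∨ (∃ T, t J < T ∧ I = Set.Ico (t J) T) ∨
          I = Set.Ici (t J)) ∧
        E = {p | (p.2 < J ∧ p.1 ∈ Set.Icc (t p.2) (t (p.2 + 1))) ∨ (p.2 = J ∧ p.1 ∈ I)})

/-- A hybrid arc: a function `(t, j) ↦ val t j` on a hybrid time domain `dom` which, for each `j`,
is locally absolutely continuous in `t` on `I_j = {t | (t, j) ∈ dom}`.
Only the values of `val` on `dom` are meaningful. -/
structure HybridArc (E : Type*) [PseudoMetricSpace E] where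
  dom : Set (ℝ × ℕ)
  val : ℝ → ℕ → E
  isHybridTimeDomain : IsHybridTimeDomain dom
  locallyAC : ∀ (j : ℕ) (a b : ℝ), a ≤ b → (∀ t ∈ Set.Icc a b, (t, j) ∈ dom) →
    AbsolutelyContinuousOnInterval (fun t => val t j) a b

/-- The interval `I_j` of ordinary times spent with jump counter `j`. -/
def HybridArc.slice {E : Type*} [PseudoMetricSpace E] (x : HybridArc E) (j : ℕ) : Set ℝ :=
  {t | (t, j) ∈ x.dom}

/-- A hybrid arc is complete if its domain is unbounded. -/
def HybridArc.IsComplete {E : Type*} [PseudoMetricSpace E] (x : HybridArc E) : Prop :=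
  ¬ Bornology.IsBounded x.dom

/-- A hybrid arc is bounded if it takes values in a bounded set. -/
def HybridArc.IsBounded {E : Type*} [PseudoMetricSpace E] (x : HybridArc E) : Prop :=
  Bornology.IsBounded {v | ∃ t j, (t, j) ∈ x.dom ∧ v = x.val t j}

/-- The distance `|x(t,j)|_𝒜` tends to `0` as `t + j → ∞` in the domain. -/
def HybridArc.ConvergesTo {E : Type*} [PseudoMetricSpace E] (x : HybridArc E) (𝒜 : Set E) : Prop :=
  ∀ ε > 0, ∃ N : ℝ, ∀ t j, (t, j) ∈ x.dom → N ≤ t + (j : ℝ) → Metric.infDist (x.val t j) 𝒜 ≤ ε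

/-- A hybrid system `(C, D, F, G)`: flow set, jump set, flow map, jump map. -/
structure HybridSystem (E : Type*) where
  C : Set E
  D : Set E
  F : E → Set E
  G : E → Set E

variable {E : Type*} [NormedAddCommGroup E] [NormedSpace ℝ E]

/-- Solutions of a hybrid system. They start in `closure C ∪ D`. The condition
`∃ s ∈ I_j, t < s` for `t ∈ I_j` says that `t ∈ [min I_j, sup I_j)`. -/
structure HybridSystem.IsSolution (H : HybridSystem E) (x : HybridArc E) : Prop where
  init : x.val 0 0 ∈ closure H.C ∪ H.D
  flow_deriv : ∀ j, (interior (x.slice j)).Nonempty →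
    ∀ᵐ t ∂(MeasureTheory.volume.restrict (x.slice j)),
      ∃ v ∈ H.F (x.val t j), HasDerivAt (fun s => x.val s j) v t
  flow_mem : ∀ j, (interior (x.slice j)).Nonempty →
    ∀ t ∈ x.slice j, (∃ s ∈ x.slice j, t < s) → x.val t j ∈ H.C
  jump : ∀ t j, (t, j) ∈ x.dom → (t, j + 1) ∈ x.dom →
    x.val t j ∈ H.D ∧ x.val t (j + 1) ∈ H.G (x.val t j)

/-- A solution is maximal if it is not the truncation of a solution to a proper subset of the
domain of the latter. -/
def HybridSystem.IsMaximalSolution (H : HybridSystem E) (x : HybridArc E) : Prop :=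
  H.IsSolution x ∧ ¬ ∃ x' : HybridArc E, H.IsSolution x' ∧ x.dom ⊂ x'.dom ∧
    ∀ t j, (t, j) ∈ x.dom → x'.val t j = x.val t j

/-! ### Stability notions -/

/-- Stability of a set. -/
def HybridSystem.IsStable (H : HybridSystem E) (𝒜 : Set E) : Prop :=
  ∀ ε > 0, ∃ δ > 0, ∀ x, H.IsSolution x → Metric.infDist (x.val 0 0) 𝒜 ≤ δ →
    ∀ t j, (t, j) ∈ x.dom → Metric.infDist (x.val t j) 𝒜 ≤ ε

/-- Attractivity of a set, including completeness of every maximal solution. -/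
def HybridSystem.IsAttractive (H : HybridSystem E) (𝒜 : Set E) : Prop :=
  (∀ x, H.IsMaximalSolution x → x.IsComplete) ∧
  ∃ δ > 0, ∀ x, H.IsSolution x → Metric.infDist (x.val 0 0) 𝒜 ≤ δ →
    x.IsBounded ∧ (x.IsComplete → x.ConvergesTo 𝒜)

/-- The points from which each solution is bounded and each complete solution converges. -/
def HybridSystem.basin (H : HybridSystem E) (𝒜 : Set E) : Set E :=
  {ξ | ∀ x, H.IsSolution x → x.val 0 0 = ξ → x.IsBounded ∧ (x.IsComplete → x.ConvergesTo 𝒜)}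

/-- Exponential stability: one exponential bound in `t + j`, valid for every solution. -/
def HybridSystem.IsExpStable (H : HybridSystem E) (𝒜 : Set E) : Prop :=
  ∃ γ > 0, ∃ k > 0, ∀ x, H.IsSolution x → ∀ t j, (t, j) ∈ x.dom →
    Metric.infDist (x.val t j) 𝒜 ≤
      k * Real.exp (-γ * (t + (j : ℝ))) * Metric.infDist (x.val 0 0) 𝒜

/-- Global asymptotic stability of a compact set. -/
def HybridSystem.IsGAS (H : HybridSystem E) (𝒜 : Set E) : Prop :=
  IsCompact 𝒜 ∧ H.IsStable 𝒜 ∧ H.IsAttractive 𝒜 ∧ H.basin 𝒜 = Set.univ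

/-- Global exponential stability of a compact set. -/
def HybridSystem.IsGES (H : HybridSystem E) (𝒜 : Set E) : Prop :=
  IsCompact 𝒜 ∧ H.IsExpStable 𝒜 ∧ H.basin 𝒜 = Set.univ

/-- Exponential stability of the linear system `ẋ = M x`, `t ≥ 0`. -/
def LinearExpStable {n : ℕ} (M : Matrix (Fin n) (Fin n) ℝ) : Prop :=
  ∃ γ > 0, ∃ k > 0, ∀ x : ℝ → EuclideanSpace ℝ (Fin n),
    (∀ t, 0 ≤ t → HasDerivWithinAt x (WithLp.toLp 2 (M *ᵥ (x t).ofLp)) (Set.Ici 0) t) →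
      ∀ t, 0 ≤ t → ‖x t‖ ≤ k * Real.exp (-γ * t) * ‖x 0‖

/-! ### The transmission-lazy closed loop in error coordinates -/

/-- The scalar deadzone function. -/
def deadzone (s : ℝ) : ℝ := if |s| ≤ 1 then 0 else Real.sign s * (|s| - 1)

/-- The space `ℝⁿ × ℝ^q` of pairs `(x, e)`, with its Euclidean norm. -/
abbrev Pair (n q : ℕ) : Type := EuclideanSpace ℝ (Fin n ⊕ Fin q)

/-- The component `x` of `(x, e)`. -/
def Pair.x {n q : ℕ} (z : Pair n q) : EuclideanSpace ℝ (Fin n) :=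
  WithLp.toLp 2 (fun i => z (Sum.inl i))

/-- The component `e` of `(x, e)`. -/
def Pair.e {n q : ℕ} (z : Pair n q) : EuclideanSpace ℝ (Fin q) :=
  WithLp.toLp 2 (fun i => z (Sum.inr i))

/-- The state space `ℝⁿ × ℝ^q × ℝ` of triples `((x, e), τ)`, with its Euclidean norm. -/
abbrev State (n q : ℕ) : Type := WithLp 2 (Pair n q × ℝ)

section Model

variable {n q : ℕ} (A : Matrix (Fin n) (Fin n) ℝ) (B : Matrix (Fin n) (Fin q) ℝ)
  (C : Matrix (Fin q) (Fin n) ℝ)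

/-- The matrix of the error dynamics, with blocks `A + BC`, `B`, `-C(A + BC)`, `-CB`. -/
def errorMatrix : Matrix (Fin n ⊕ Fin q) (Fin n ⊕ Fin q) ℝ :=
  Matrix.fromBlocks (A + B * C) B (-(C * (A + B * C))) (-(C * B))

/-- The linear vector field `(x, e) ↦ F (x, e)`. -/
def errorField (z : Pair n q) : Pair n q :=
  WithLp.toLp 2 (errorMatrix A B C *ᵥ z.ofLp)

/-- The block diagonal matrix `P` with diagonal blocks `P₁` and `P₂`. -/
def blockP (P₁ : Matrix (Fin n) (Fin n) ℝ) (P₂ : Matrix (Fin q) (Fin q) ℝ) :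
    Matrix (Fin n ⊕ Fin q) (Fin n ⊕ Fin q) ℝ :=
  Matrix.fromBlocks P₁ 0 0 P₂

/-- `V(x, e) = ½ (x, e)ᵀ P (x, e)`. -/
def lyapV (P₁ : Matrix (Fin n) (Fin n) ℝ) (P₂ : Matrix (Fin q) (Fin q) ℝ) (z : Pair n q) : ℝ :=
  (1 / 2) * (z.ofLp ⬝ᵥ (blockP P₁ P₂ *ᵥ z.ofLp))

/-- The conditions on `γₓ`, `Q` and `V`. `Matrix.PosDef` and `Matrix.PosSemidef` include
symmetry; the last two fields are `(A + BC)ᵀ P₁ + P₁ (A + BC) ≤ -Q` and `γₓ I < Q`. -/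
structure CondS1 (γx : ℝ) (Q P₁ : Matrix (Fin n) (Fin n) ℝ) (P₂ : Matrix (Fin q) (Fin q) ℝ) :
    Prop where
  γx_pos : 0 < γx
  Q_posDef : Q.PosDef
  P_posDef : (blockP P₁ P₂).PosDef
  lyap : (-Q - ((A + B * C)ᵀ * P₁ + P₁ * (A + B * C))).PosSemidef
  γx_lt : (Q - γx • (1 : Matrix (Fin n) (Fin n) ℝ)).PosDef

/-- The set of pairs `(x, e)` for which no transmission is required. -/
def flowPairs (γx γe : ℝ) (P₁ : Matrix (Fin n) (Fin n) ℝ) (P₂ : Matrix (Fin q) (Fin q) ℝ) :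
    Set (Pair n q) :=
  {z | inner ℝ (∇ (lyapV P₁ P₂) z) (errorField A B C z) ≤ -γx * ‖z.x‖ ^ 2 ∧
    ‖z.e‖ ≤ γe * ‖z.x‖}

/-- The set of pairs `(x, e)` that trigger a transmission. -/
def jumpPairs (γx γe : ℝ) (P₁ : Matrix (Fin n) (Fin n) ℝ) (P₂ : Matrix (Fin q) (Fin q) ℝ) :
    Set (Pair n q) :=
  {z | -γx * ‖z.x‖ ^ 2 ≤ inner ℝ (∇ (lyapV P₁ P₂) z) (errorField A B C z) ∨
    γe * ‖z.x‖ ≤ ‖z.e‖}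

/-- The synchronous closed loop with flow pairs `Cbar`, jump pairs `Dbar` and timer parameters
`Δ`, `ρ`. The timer takes values in `[0, ∞)`. -/
def syncLoop (Cbar Dbar : Set (Pair n q)) (Δ ρ : ℝ) : HybridSystem (State n q) where
  C := {X | 0 ≤ X.snd ∧ (X.fst ∈ Cbar ∨ X.snd ≤ Δ)}
  D := {X | X.fst ∈ Dbar ∧ Δ ≤ X.snd}
  F := fun X => {WithLp.toLp 2 (errorField A B C X.fst, 1 - deadzone (X.snd / ρ))}
  G := fun X => {WithLp.toLp 2 (WithLp.toLp 2 (Sum.elim X.fst.x.ofLp 0), 0)}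

end Model

/-- The set `{0} × {0} × [0, 2ρ]`. -/
def targetSet (n q : ℕ) (ρ : ℝ) : Set (State n q) :=
  {X | X.fst = 0 ∧ X.snd ∈ Set.Icc 0 (2 * ρ)}

end TLazy

end

namespace TLazy

/-! ### Regularity of flows and structure of hybrid arcs -/

open Set MeasureTheory Filter Topology

/-! The function `V` decays exponentially in ordinary time, up to an overshoot created at the start,
and a dwell time between jumps converts this into decay in `t + j`. A jump sets `e = 0`, which
cannot increase `V` because `P` is block diagonal. At a point with `e = 0` the Lyapunov inequality
makes the rate of `V` at most `-(γx / 2) |z|²`. Linear trajectories move little in a short time, so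
the rate stays negative for a time `ρ₀` that depends only on the matrices and `γx`. The timer has
slope one below `ρ`, so after a jump the loop can be kept flowing by `τ ≤ Δ` only for a time at most
`Δ < ρ₀`. Any later flow takes place in the flow pairs, where the rate is at most `-γx |x|²` and
`|e| ≤ γe |x|` bounds `|z|` by `|x|`. Both regimes are handled by `CondS1.exists_decay`. Only the
first interval can flow outside the flow pairs with `e ≠ 0`. This lasts at most `Δ`, and
`CondS1.exists_growth` turns it into a constant factor. Meanwhile the excess of the timer over `2ρ`
decays at rate `1/ρ`. Every jump after the first costs at least `Δ` of ordinary time, hence `(j - 1)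
Δ ≤ t`. These estimates form `CondS1.exists_lyapV_decay`, and `CondS1.exists_isExpStable` assembles
them into the exponential bound in `t + j`. Stability, boundedness, convergence and the global basin
all follow from that bound. Completeness of maximal solutions is a separate extension argument,
`syncLoop_isComplete`: a bounded solution with bounded domain can always be prolonged by a jump or
by a flow. -/

theorem hasDerivWithinAt_of_absolutelyContinuous {E : Type*} [NormedAddCommGroup E]
    [NormedSpace ℝ E] [CompleteSpace E] {f : E → E} (hf : Continuous f) {y : ℝ → E} {a b : ℝ}
    (hab : a ≤ b) (hac : AbsolutelyContinuousOnInterval y a b)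
    (hd : ∀ᵐ t, t ∈ Icc a b → HasDerivAt y (f (y t)) t) :
    ∀ t ∈ Icc a b, HasDerivWithinAt y (f (y t)) (Icc a b) t := by
  have hyc : ContinuousOn y (Icc a b) := by
    simpa [uIcc_of_le hab] using hac.continuousOn
  -- Extending the right-hand side continuously to the whole line makes its primitive `g`
  -- differentiable everywhere. Then `y - g` is absolutely continuous with zero derivative almost
  -- everywhere, hence constant.
  set h : ℝ → E := IccExtend hab ((Icc a b).domRestrict fun s => f (y s)) with hh
  have hcont : Continuous h := by
    apply Continuous.Icc_extend'
    exact (hf.comp_continuousOn hyc).domRestrict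
  have heq : ∀ t ∈ Icc a b, h t = f (y t) := fun t ht => by
    rw [hh, IccExtend_of_mem hab _ ht]; rfl
  set g : ℝ → E := fun t => ∫ s in a..t, h s with hg
  have hgd : ∀ t, HasDerivAt g (h t) t := fun t =>
    intervalIntegral.integral_hasDerivAt_right (hcont.intervalIntegrable _ _)
      (hcont.stronglyMeasurableAtFilter _ _) hcont.continuousAt
  have hglip : AbsolutelyContinuousOnInterval g a b := by
    obtain ⟨K, hK⟩ := (isCompact_Icc (a := a) (b := b)).exists_bound_of_continuousOn
      hcont.continuousOn
    have : LipschitzOnWith K.toNNReal g (uIcc a b) := by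
      rw [uIcc_of_le hab]
      refine (convex_Icc a b).lipschitzOnWith_of_nnnorm_hasDerivWithin_le
        (fun t _ => (hgd t).hasDerivWithinAt) fun t ht => ?_
      rw [← NNReal.coe_le_coe, coe_nnnorm]
      exact (hK t ht).trans (Real.le_coe_toNNReal K)
    exact this.absolutelyContinuousOnInterval
  obtain ⟨c, hc⟩ := (hac.sub hglip).const_of_ae_hasDerivAt_zero (by
    filter_upwards [hd] with t ht hmem
    rw [uIcc_of_le hab] at hmem
    have := (ht hmem).sub (hgd t)
    rwa [heq t hmem, sub_self] at this)
  rw [uIcc_of_le hab] at hc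
  intro t ht
  have h1 : HasDerivWithinAt (fun s => g s + c) (f (y t)) (Icc a b) t := by
    rw [← heq t ht]; exact ((hgd t).add_const c).hasDerivWithinAt
  refine h1.congr (fun s hs => ?_) ?_
  · have := hc s hs; simp only [Pi.sub_apply] at this; rw [← this]; abel
  · have := hc t ht; simp only [Pi.sub_apply] at this; rw [← this]; abel

namespace HybridArc

variable {E : Type*} [PseudoMetricSpace E] (x : HybridArc E)

theorem slice_ordConnected (j : ℕ) : (x.slice j).OrdConnected := by
  obtain ⟨t, -, -, h | ⟨J, I, hI, h⟩⟩ := x.isHybridTimeDomain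
  · have : x.slice j = Icc (t j) (t (j + 1)) := by ext s; simp [slice, h]
    rw [this]; exact ordConnected_Icc
  · have hIc : I.OrdConnected := by
      rcases hI with ⟨T, -, rfl⟩ | ⟨T, -, rfl⟩ | rfl
      exacts [ordConnected_Icc, ordConnected_Ico, ordConnected_Ici]
    rcases lt_trichotomy j J with hj | rfl | hj
    · have : x.slice j = Icc (t j) (t (j + 1)) := by
        ext s; simp [slice, h, hj, hj.ne]
      rw [this]; exact ordConnected_Icc
    · have : x.slice j = I := by ext s; simp [slice, h]
      rwa [this]
    · have : x.slice j = ∅ := by ext s; simp [slice, h, hj.not_gt, hj.ne']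
      rw [this]; exact ordConnected_empty

theorem zero_mem_dom : ((0 : ℝ), 0) ∈ x.dom := by
  obtain ⟨t, h0, hm, h | ⟨J, I, hI, h⟩⟩ := x.isHybridTimeDomain
  · rw [h]; simpa [h0] using h0 ▸ hm (Nat.zero_le 1)
  · rw [h]
    rcases Nat.eq_zero_or_pos J with rfl | hJ
    · right
      rcases hI with ⟨T, hT, rfl⟩ | ⟨T, hT, rfl⟩ | rfl <;> simp_all
    · left
      refine ⟨hJ, ?_⟩
      simpa [h0] using h0 ▸ hm (Nat.zero_le 1)

theorem nonneg_of_mem_dom {s : ℝ} (hs : (s, 0) ∈ x.dom) : 0 ≤ s := by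
  obtain ⟨t, h0, hm, h | ⟨J, I, hI, h⟩⟩ := x.isHybridTimeDomain
  · rw [h] at hs; exact h0 ▸ hs.1
  · rw [h] at hs
    rcases hs with ⟨-, hs⟩ | ⟨hj, hs⟩
    · exact h0 ▸ hs.1
    · simp only at hj hs
      subst hj
      rw [h0] at hI
      rcases hI with ⟨T, hT, rfl⟩ | ⟨T, hT, rfl⟩ | rfl
      exacts [hs.1, hs.1, hs]

theorem exists_jump_time {s : ℝ} {j : ℕ} (hs : (s, j + 1) ∈ x.dom) :
    ∃ a ≤ s, (a, j) ∈ x.dom ∧ (a, j + 1) ∈ x.dom := by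
  obtain ⟨t, h0, hm, h | ⟨J, I, hI, h⟩⟩ := x.isHybridTimeDomain
  · rw [h] at hs ⊢
    exact ⟨t (j + 1), hs.1, ⟨hm (Nat.le_succ j), le_rfl⟩, ⟨le_rfl, hm (Nat.le_succ _)⟩⟩
  · rw [h] at hs ⊢
    rcases hs with ⟨hj, hs⟩ | ⟨hj, hs⟩
    · exact ⟨t (j + 1), hs.1, Or.inl ⟨(Nat.lt_succ_self j).trans hj, hm (Nat.le_succ j), le_rfl⟩,
        Or.inl ⟨hj, le_rfl, hm (Nat.le_succ _)⟩⟩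
    · simp only at hj hs
      subst hj
      have h1 : t (j + 1) ∈ I ∧ t (j + 1) ≤ s := by
        rcases hI with ⟨T, hT, rfl⟩ | ⟨T, hT, rfl⟩ | rfl
        exacts [⟨⟨le_rfl, hT⟩, hs.1⟩, ⟨⟨le_rfl, hT⟩, hs.1⟩, ⟨self_mem_Ici, hs⟩]
      exact ⟨t (j + 1), h1.2, Or.inl ⟨Nat.lt_succ_self j, hm (Nat.le_succ j), le_rfl⟩,
        Or.inr ⟨rfl, h1.1⟩⟩

/-- Infinitely many jumps would make `j` unbounded, and a last interval reaching infinity would make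
`t` unbounded. Only the two bounded shapes of the last interval survive. -/
theorem exists_last_interval (hx : ¬ x.IsComplete) :
    ∃ (t : ℕ → ℝ) (J : ℕ) (I : Set ℝ) (T : ℝ), t 0 = 0 ∧ Monotone t ∧
      (t J ≤ T ∧ I = Icc (t J) T ∨ t J < T ∧ I = Ico (t J) T) ∧
      x.dom = {p | (p.2 < J ∧ p.1 ∈ Icc (t p.2) (t (p.2 + 1))) ∨ (p.2 = J ∧ p.1 ∈ I)} := by
  have hb : Bornology.IsBounded x.dom := by simpa [IsComplete] using hx
  obtain ⟨R, hR⟩ := hb.subset_closedBall ((0 : ℝ), 0)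
  have hR' : ∀ s j, (s, j) ∈ x.dom → |s| ≤ R ∧ (j : ℝ) ≤ R := fun s j h => by
    have := hR h
    rw [Metric.mem_closedBall, Prod.dist_eq, max_le_iff, Nat.dist_eq] at this
    simpa using this
  obtain ⟨t, h0, hm, h | ⟨J, I, hI, h⟩⟩ := x.isHybridTimeDomain
  · obtain ⟨N, hN⟩ := exists_nat_gt R
    have : (t N, N) ∈ x.dom := by rw [h]; exact ⟨le_rfl, hm (Nat.le_succ N)⟩
    exact absurd (hR' _ _ this).2 hN.not_ge
  · rcases hI with ⟨T, hT, hI⟩ | ⟨T, hT, hI⟩ | hI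
    · exact ⟨t, J, I, T, h0, hm, Or.inl ⟨hT, hI⟩, h⟩
    · exact ⟨t, J, I, T, h0, hm, Or.inr ⟨hT, hI⟩, h⟩
    · have : (max (t J) (R + 1), J) ∈ x.dom := by
        rw [h, hI]; right; exact ⟨rfl, le_max_left (t J) (R + 1)⟩
      have h1 := (hR' _ _ this).1
      have h2 := (le_abs_self _).trans h1
      have h3 := le_max_right (t J) (R + 1)
      linarith

end HybridArc

/-! ### Classical flow equations and extension of solutions -/

namespace HybridSystem

variable {E : Type*} [NormedAddCommGroup E] [NormedSpace ℝ E] {H : HybridSystem E}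
  {x : HybridArc E}

/-- For a continuous single-valued flow map the almost-everywhere inclusion becomes a classical
differential equation, so differential inequalities can be used at every time, endpoints included.
-/
theorem IsSolution.hasDerivWithinAt [CompleteSpace E] (hx : H.IsSolution x) {f : E → E}
    (hf : Continuous f) (hF : ∀ ξ, H.F ξ = {f ξ}) {j : ℕ} {a b : ℝ} (hab : a < b)
    (hsub : Icc a b ⊆ x.slice j) :
    (∀ t ∈ Icc a b, HasDerivWithinAt (fun s => x.val s j) (f (x.val t j)) (Icc a b) t) ∧
      ∀ t ∈ Ico a b, x.val t j ∈ H.C := by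
  have hne : (interior (x.slice j)).Nonempty :=
    ⟨(a + b) / 2, interior_mono hsub (by rw [interior_Icc]; constructor <;> linarith)⟩
  refine ⟨?_, fun t ht => hx.flow_mem j hne t (hsub ⟨ht.1, ht.2.le⟩)
    ⟨b, hsub ⟨hab.le, le_rfl⟩, ht.2⟩⟩
  refine hasDerivWithinAt_of_absolutelyContinuous hf hab.le (x.locallyAC j a b hab.le hsub) ?_
  have := hx.flow_deriv j hne
  rw [ae_restrict_iff' (x.slice_ordConnected j).measurableSet] at this
  filter_upwards [this] with t ht hmem
  obtain ⟨v, hv, hd⟩ := ht (hsub hmem)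
  rw [hF] at hv
  rwa [← mem_singleton_iff.1 hv]

/-- The added slice is the single point `T`. Its interior is empty, so it carries no flow condition,
and only the new jump has to be checked. -/
theorem IsSolution.not_isMaximal_of_jump (hx : H.IsSolution x) {t : ℕ → ℝ} {J : ℕ} {T : ℝ}
    (h0 : t 0 = 0) (hm : Monotone t) (hT : t J ≤ T)
    (hdom : x.dom = {p | (p.2 < J ∧ p.1 ∈ Icc (t p.2) (t (p.2 + 1))) ∨
      (p.2 = J ∧ p.1 ∈ Icc (t J) T)})
    {ξ : E} (hD : x.val T J ∈ H.D) (hξ : ξ ∈ H.G (x.val T J)) :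
    ¬ H.IsMaximalSolution x := by
  rintro ⟨-, hmax⟩
  apply hmax
  have hle : ∀ s j, (s, j) ∈ x.dom → j ≤ J := fun s j h => by
    rw [hdom] at h
    rcases h with h | h
    exacts [h.1.le, h.1.le]
  let y : HybridArc E :=
    { dom := x.dom ∪ {(T, J + 1)}
      val := fun s j => if j = J + 1 then ξ else x.val s j
      isHybridTimeDomain := by
        -- The jump times are kept up to index `J` and frozen at `T` from `J + 1` on.
        refine ⟨fun k => if k ≤ J then t k else T, by simp [h0], ?_, Or.inr ⟨J + 1, Icc T T,
          Or.inl ⟨T, by simp, by simp⟩, ?_⟩⟩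
        · intro k l hkl
          by_cases hk : k ≤ J <;> by_cases hl : l ≤ J
          · simpa [hk, hl] using hm hkl
          · simpa [hk, hl] using (hm hk).trans hT
          · omega
          · simp [hk, hl]
        · ext ⟨s, j⟩
          rw [hdom]
          simp only [mem_union, mem_ofPred_eq, mem_singleton_iff, Prod.mk.injEq, Icc_self]
          rcases lt_trichotomy j J with hj | rfl | hj
          · have h1 : j ≤ J := hj.le
            have h2 : j + 1 ≤ J := hj
            have h3 : j < J + 1 := by omega
            simp [hj, hj.ne, h1, h3, h2, show j ≠ J + 1 by omega]
          · simp
          · by_cases hj' : j = J + 1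
            · subst hj'; simp
            · have h1 : ¬ j < J := by omega
              have h2 : ¬ j < J + 1 := by omega
              have h3 : j ≠ J := by omega
              simp [h1, h2, h3, hj']
      locallyAC := by
        intro j a b hab h
        by_cases hj : j = J + 1
        · subst hj
          simp only [if_true]
          exact (LipschitzWith.const ξ).lipschitzOnWith.absolutelyContinuousOnInterval
        · simp only [hj, if_false]
          refine x.locallyAC j a b hab fun s hs => ?_
          rcases h s hs with h | h
          · exact h
          · exact absurd (Prod.mk.inj h).2 hj }
  have hyslice : ∀ j, j ≠ J + 1 → y.slice j = x.slice j := fun j hj => by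
    ext s
    simp [HybridArc.slice, y, hj]
  have hyslice' : y.slice (J + 1) = {T} := by
    ext s
    have : (s, J + 1) ∉ x.dom := fun h => by have := hle _ _ h; omega
    simp [HybridArc.slice, y, this]
  have hyval : ∀ s j, j ≠ J + 1 → y.val s j = x.val s j := fun s j hj => by simp [y, hj]
  refine ⟨y, ⟨?_, ?_, ?_, ?_⟩, ?_, ?_⟩
  · rw [hyval _ _ (by omega)]; exact hx.init
  · intro j hj
    by_cases h : j = J + 1
    · subst h; rw [hyslice'] at hj; simp at hj
    · rw [hyslice j h] at hj ⊢
      simpa [y, h] using hx.flow_deriv j hj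
  · intro j hj
    by_cases h : j = J + 1
    · subst h; rw [hyslice'] at hj; simp at hj
    · rw [hyslice j h] at hj ⊢
      simpa [y, h] using hx.flow_mem j hj
  · intro s j h1 h2
    rcases h1 with h1 | h1
    · have hj := hle _ _ h1
      rw [hyval _ _ (by omega)]
      rcases h2 with h2 | h2
      · have := hle _ _ h2
        rw [hyval _ _ (by omega)]
        exact hx.jump s j h1 h2
      · obtain ⟨rfl, h⟩ := Prod.mk.inj h2
        have : j = J := by omega
        subst this
        simpa [y] using ⟨hD, hξ⟩
    · obtain ⟨rfl, rfl⟩ := Prod.mk.inj h1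
      rcases h2 with h2 | h2
      · have := hle _ _ h2; omega
      · have := (Prod.mk.inj h2).2; omega
  · refine ⟨subset_union_left, fun h => ?_⟩
    have := hle _ _ (h (Or.inr rfl : (T, J + 1) ∈ y.dom))
    omega
  · intro s j h
    have := hle _ _ h
    exact hyval _ _ (by omega)

/-- The last slice is replaced by the graph of `y` on a longer closed interval. This covers both
adding a missing right endpoint and gluing on a new piece of flow. -/
theorem IsSolution.not_isMaximal_of_flow (hx : H.IsSolution x) {t : ℕ → ℝ} {J : ℕ} {I : Set ℝ}
    {T : ℝ} (h0 : t 0 = 0) (hm : Monotone t) (hT : t J < T)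
    (hdom : x.dom = {p | (p.2 < J ∧ p.1 ∈ Icc (t p.2) (t (p.2 + 1))) ∨ (p.2 = J ∧ p.1 ∈ I)})
    (hmemI : t J ∈ I) (hI : I ⊂ Icc (t J) T) {y : ℝ → E} {K : NNReal}
    (hy : LipschitzOnWith K y (Icc (t J) T)) (hyx : ∀ s ∈ I, y s = x.val s J)
    (hyd : ∀ᵐ s, s ∈ Ioo (t J) T → ∃ v ∈ H.F (y s), HasDerivAt y v s)
    (hyC : ∀ s ∈ Ico (t J) T, y s ∈ H.C) :
    ¬ H.IsMaximalSolution x := by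
  rintro ⟨-, hmax⟩
  apply hmax
  let z : HybridArc E :=
    { dom := {p | (p.2 < J ∧ p.1 ∈ Icc (t p.2) (t (p.2 + 1))) ∨ (p.2 = J ∧ p.1 ∈ Icc (t J) T)}
      val := fun s j => if j = J then y s else x.val s j
      isHybridTimeDomain := ⟨t, h0, hm, Or.inr ⟨J, Icc (t J) T, Or.inl ⟨T, hT.le, rfl⟩, rfl⟩⟩
      locallyAC := by
        intro j a b hab h
        by_cases hj : j = J
        · subst hj
          simp only [if_true]
          refine (hy.mono fun s hs => ?_).absolutelyContinuousOnInterval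
          rw [uIcc_of_le hab] at hs
          simpa using h s hs
        · simp only [hj, if_false]
          refine x.locallyAC j a b hab fun s hs => ?_
          rw [hdom]
          simpa [hj] using h s hs }
  have hslice : ∀ j, j ≠ J → z.slice j = x.slice j := fun j hj => by
    ext s; simp [HybridArc.slice, z, hj, hdom]
  have hslice' : z.slice J = Icc (t J) T := by
    ext s; simp [HybridArc.slice, z]
  have hval : ∀ s j, j ≠ J → z.val s j = x.val s j := fun s j hj => by simp [z, hj]
  have hval' : ∀ s, z.val s J = y s := fun s => by simp [z]
  have hvx : ∀ s j, (s, j) ∈ x.dom → z.val s j = x.val s j := fun s j h => by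
    by_cases hj : j = J
    · subst hj
      rw [hdom] at h
      rw [hval']
      exact hyx s (by simpa using h)
    · exact hval _ _ hj
  refine ⟨z, ⟨?_, ?_, ?_, ?_⟩, ?_, hvx⟩
  · rw [hvx _ _ x.zero_mem_dom]; exact hx.init
  · intro j hj
    by_cases h : j = J
    · subst h
      rw [hslice', ae_restrict_iff' measurableSet_Icc]
      have h1 : ∀ᵐ s : ℝ, s ≠ t j := by simp [ae_iff]
      have h2 : ∀ᵐ s : ℝ, s ≠ T := by simp [ae_iff]
      filter_upwards [hyd, h1, h2] with s hs hs1 hs2 hmem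
      simpa [z] using hs ⟨lt_of_le_of_ne hmem.1 hs1.symm, lt_of_le_of_ne hmem.2 hs2⟩
    · rw [hslice j h] at hj ⊢
      simpa [z, h] using hx.flow_deriv j hj
  · intro j hj
    by_cases h : j = J
    · subst h
      rw [hslice']
      rintro s hs ⟨r, hr, hsr⟩
      rw [hval']
      exact hyC s ⟨hs.1, hsr.trans_le hr.2⟩
    · rw [hslice j h] at hj ⊢
      simpa [z, h] using hx.flow_mem j hj
  · intro s j h1 h2
    have h2J : j < J := by
      rcases h2 with h | h
      · exact (Nat.lt_succ_self j).trans h.1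
      · exact (Nat.lt_succ_self j).trans_eq h.1
    have h1' : (s, j) ∈ x.dom := by
      rw [hdom]
      rcases h1 with h | h
      · exact Or.inl h
      · exact absurd h.1 h2J.ne
    have hle : s ≤ t (j + 1) := by
      rcases h1 with h | h
      · exact h.2.2
      · exact absurd h.1 h2J.ne
    have h2' : (s, j + 1) ∈ x.dom := by
      rw [hdom]
      rcases h2 with h | ⟨h, h'⟩
      · exact Or.inl h
      · simp only at h h'
        refine Or.inr ⟨h, ?_⟩
        -- A jump into the last slice can only occur at its initial time, which already lies in `I`,
        -- so lengthening that slice creates no new jumps.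
        subst h
        have : s = t (j + 1) := le_antisymm hle h'.1
        simpa [this] using hmemI
    rw [hvx _ _ h1', hvx _ _ h2']
    exact hx.jump s j h1' h2'
  · obtain ⟨h1, h2⟩ := hI
    refine ⟨?_, fun h => h2 fun s hs => ?_⟩
    · rw [hdom]
      rintro p (hp | hp)
      · exact Or.inl hp
      · exact Or.inr ⟨hp.1, h1 hp.2⟩
    · have : (s, J) ∈ x.dom := h (Or.inr ⟨rfl, hs⟩)
      rw [hdom] at this
      simpa using this

end HybridSystem

/-! ### Scalar differential inequalities and the timer -/

/-- The integrating factor `exp (c (t - a))` makes the product nonincreasing. The sign of `c` is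
free: `c = 0` gives monotonicity, and negative `c` gives a growth bound. -/
theorem le_exp_mul_of_hasDerivWithinAt {v v' : ℝ → ℝ} {a b c : ℝ} (hab : a ≤ b)
    (hv : ∀ t ∈ Icc a b, HasDerivWithinAt v (v' t) (Icc a b) t)
    (hle : ∀ t ∈ Ioo a b, v' t ≤ -c * v t) : v b ≤ Real.exp (-c * (b - a)) * v a := by
  have key : AntitoneOn (fun t => Real.exp (c * (t - a)) * v t) (Icc a b) := by
    have hd : ∀ t ∈ Ioo a b, HasDerivAt (fun t => Real.exp (c * (t - a)) * v t)
        (Real.exp (c * (t - a)) * (c * 1) * v t + Real.exp (c * (t - a)) * v' t) t :=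
      fun t ht => ((((hasDerivAt_id t).sub_const a).const_mul c).exp).mul
        ((hv t (Ioo_subset_Icc_self ht)).hasDerivAt (Icc_mem_nhds ht.1 ht.2))
    refine antitoneOn_of_deriv_nonpos (convex_Icc a b) ?_ ?_ ?_
    · have : ContinuousOn v (Icc a b) := fun t ht => (hv t ht).continuousWithinAt
      fun_prop
    · rw [interior_Icc]
      exact fun t ht => (hd t ht).differentiableAt.differentiableWithinAt
    · rw [interior_Icc]
      intro t ht
      rw [(hd t ht).deriv]
      have := hle t ht
      have h2 := Real.exp_pos (c * (t - a))
      nlinarith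
  have h := key ⟨le_rfl, hab⟩ ⟨hab, le_rfl⟩ hab
  simp only [sub_self, mul_zero, Real.exp_zero, one_mul] at h
  calc v b = Real.exp (-c * (b - a)) * (Real.exp (c * (b - a)) * v b) := by
        rw [← mul_assoc, ← Real.exp_add]; simp
    _ ≤ _ := by gcongr

theorem deadzone_eq (s : ℝ) : deadzone s = s - max (-1) (min 1 s) := by
  unfold deadzone
  split_ifs with h
  · rw [abs_le] at h
    rw [min_eq_right h.2, max_eq_right h.1, sub_self]
  · rw [not_le, lt_abs] at h
    rcases h with h | h
    · rw [Real.sign_of_pos (by linarith), abs_of_pos (by linarith), min_eq_left h.le,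
        max_eq_right (by norm_num)]; ring
    · rw [Real.sign_of_neg (by linarith), abs_of_neg (by linarith), min_eq_right (by linarith),
        max_eq_left (by linarith)]; ring

theorem continuous_deadzone : Continuous deadzone := by
  have : deadzone = fun s => s - max (-1) (min 1 s) := funext deadzone_eq
  rw [this]; fun_prop

theorem deadzone_nonneg {s : ℝ} (hs : 0 ≤ s) : 0 ≤ deadzone s := by
  rw [deadzone_eq, sub_nonneg, max_le_iff]
  exact ⟨by linarith, min_le_right _ _⟩

theorem sub_one_le_deadzone (s : ℝ) : s - 1 ≤ deadzone s := by
  rw [deadzone_eq]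
  have : max (-1) (min 1 s) ≤ 1 := max_le (by norm_num) (min_le_left _ _)
  linarith

theorem deadzone_of_mem {s : ℝ} (h0 : 0 ≤ s) (h1 : s ≤ 1) : deadzone s = 0 := by
  rw [deadzone, if_pos (by rwa [abs_of_nonneg h0])]

theorem deadzone_of_one_le {s : ℝ} (h1 : 1 ≤ s) : deadzone s = s - 1 := by
  rw [deadzone_eq, min_eq_left h1, max_eq_right (by norm_num)]

section Timer

variable {τ : ℝ → ℝ} {a b ρ : ℝ}

theorem timer_sub_le (hρ : 0 < ρ) (hab : a ≤ b)
    (hτ : ∀ t ∈ Icc a b, HasDerivWithinAt τ (1 - deadzone (τ t / ρ)) (Icc a b) t)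
    (hτ0 : ∀ t ∈ Icc a b, 0 ≤ τ t) : τ b - τ a ≤ b - a := by
  have h := le_exp_mul_of_hasDerivWithinAt (v := fun t => τ t - t) (c := 0) hab
    (fun t ht => (hτ t ht).sub (hasDerivWithinAt_id t _)) fun t ht => by
      have := deadzone_nonneg (div_nonneg (hτ0 t (Ioo_subset_Icc_self ht)) hρ.le)
      linarith
  simp only [neg_zero, zero_mul, Real.exp_zero, one_mul] at h
  linarith

/-- Since `dz(s) ≥ s - 1`, the slope of `τ - 2ρ` is at most `2 - τ/ρ = -(τ - 2ρ)/ρ`. -/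
theorem timer_excess_le (hρ : 0 < ρ) (hab : a ≤ b)
    (hτ : ∀ t ∈ Icc a b, HasDerivWithinAt τ (1 - deadzone (τ t / ρ)) (Icc a b) t) :
    max 0 (τ b - 2 * ρ) ≤ Real.exp (-(1 / ρ) * (b - a)) * max 0 (τ a - 2 * ρ) := by
  have h := le_exp_mul_of_hasDerivWithinAt (v := fun t => τ t - 2 * ρ) (c := 1 / ρ) hab
    (fun t ht => (hτ t ht).sub_const _) fun t ht => by
      have := sub_one_le_deadzone (τ t / ρ)
      have : -(1 / ρ) * (τ t - 2 * ρ) = 2 - τ t / ρ := by field_simp; ring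
      linarith
  refine max_le (by positivity) (h.trans ?_)
  gcongr
  exact le_max_right _ _

/-- At any level in `[0, ρ]` the timer has slope one, so it cannot cross that level downwards. -/
theorem timer_le_of_le (hρ : 0 < ρ) (hab : a ≤ b)
    (hτ : ∀ t ∈ Icc a b, HasDerivWithinAt τ (1 - deadzone (τ t / ρ)) (Icc a b) t)
    {c : ℝ} (hc0 : 0 ≤ c) (hc : c ≤ ρ) (ha : c ≤ τ a) : c ≤ τ b := by
  have h := image_le_of_deriv_right_lt_deriv_boundary (f := fun t => -τ t)
    (f' := fun t => -(1 - deadzone (τ t / ρ))) (a := a) (b := b) (B := fun _ => -c)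
    (B' := fun _ => 0) (fun t ht => (hτ t ht).neg.continuousWithinAt)
    (fun t ht => ((hτ t (Ico_subset_Icc_self ht)).neg).mono_of_mem_nhdsWithin
      (Icc_mem_nhdsGE_of_mem ht)) (by simpa using ha) (fun t => hasDerivAt_const t _)
    (fun t ht h => by
      have h' : τ t = c := by simpa using h
      rw [h', deadzone_of_mem (by positivity) (by rwa [div_le_one hρ])]
      norm_num)
  simpa using h ⟨hab, le_rfl⟩

/-- A timer that ends at most at `Δ < ρ` never exceeded `Δ`, so it ran at slope one throughout.
Hence a low timer reading bounds the elapsed time. -/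
theorem le_timer_sub (hρ : 0 < ρ) (hab : a ≤ b)
    (hτ : ∀ t ∈ Icc a b, HasDerivWithinAt τ (1 - deadzone (τ t / ρ)) (Icc a b) t)
    (hτ0 : ∀ t ∈ Icc a b, 0 ≤ τ t)
    {Δ : ℝ} (hΔ : Δ < ρ) (hb : τ b ≤ Δ) : b - a ≤ τ b - τ a := by
  have hle : ∀ t ∈ Icc a b, τ t ≤ Δ := by
    intro t ht
    by_contra! hlt
    have hsub : Icc t b ⊆ Icc a b := Icc_subset_Icc_left ht.1
    have := timer_le_of_le hρ ht.2 (fun s hs => (hτ s (hsub hs)).mono hsub)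
      -- The barrier is available only for levels up to `ρ`. Both `τ t` and `ρ` exceed `Δ`, so their
      -- minimum still contradicts `τ b ≤ Δ`.
      (c := min (τ t) ρ) (le_min (hτ0 t ht) hρ.le)
      (min_le_right _ _) (min_le_left _ _)
    have h2 := lt_min hlt hΔ
    linarith
  have h := le_exp_mul_of_hasDerivWithinAt (v := fun t => t - τ t) (c := 0) hab
    (fun t ht => (hasDerivWithinAt_id t _).sub (hτ t ht)) fun t ht => by
      have ht' := Ioo_subset_Icc_self ht
      rw [deadzone_of_mem (div_nonneg (hτ0 t ht') hρ.le)
        (by rw [div_le_one hρ]; exact (hle t ht').trans hΔ.le)]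
      simp
  simp only [neg_zero, zero_mul, Real.exp_zero, one_mul] at h
  linarith

end Timer

/-! ### The quadratic Lyapunov function -/

theorem exists_pos_mul_sq_le_inner {E : Type*} [NormedAddCommGroup E] [InnerProductSpace ℝ E]
    [FiniteDimensional ℝ E] (P : E →L[ℝ] E) (hP : ∀ z, z ≠ 0 → 0 < inner ℝ z (P z)) :
    ∃ p > 0, ∀ z, p * ‖z‖ ^ 2 ≤ inner ℝ z (P z) := by
  have hnorm : ∀ z : E, z ≠ 0 → ‖z‖⁻¹ • z ∈ Metric.sphere (0 : E) 1 := fun z hz => by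
    simp [norm_smul, hz]
  -- The unit sphere is empty exactly for the zero space. Otherwise the constant is the minimum of
  -- the form on it, and homogeneity does the rest.
  rcases (Metric.sphere (0 : E) 1).eq_empty_or_nonempty with he | hne
  · refine ⟨1, one_pos, fun z => ?_⟩
    by_cases hz : z = 0
    · simp [hz]
    · have := hnorm z hz; rw [he] at this; exact this.elim
  · obtain ⟨w, hw, hmin⟩ := (isCompact_sphere (0 : E) 1).exists_isMinOn hne
      (f := fun z => inner ℝ z (P z)) (by fun_prop)
    have hw0 : w ≠ 0 := by rintro rfl; simp at hw
    refine ⟨_, hP w hw0, fun z => ?_⟩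
    by_cases hz : z = 0
    · simp [hz]
    · have h : inner ℝ w (P w) ≤ inner ℝ (‖z‖⁻¹ • z) (P (‖z‖⁻¹ • z)) := hmin (hnorm z hz)
      rw [map_smul, inner_smul_left, inner_smul_right] at h
      have hz' : 0 < ‖z‖ := norm_pos_iff.2 hz
      simp only [conj_trivial] at h
      calc _ ≤ (‖z‖⁻¹ * (‖z‖⁻¹ * inner ℝ z (P z))) * ‖z‖ ^ 2 := by gcongr
        _ = _ := by field_simp

section Lyapunov

variable {n q : ℕ} {A : Matrix (Fin n) (Fin n) ℝ} {B : Matrix (Fin n) (Fin q) ℝ}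
  {C : Matrix (Fin q) (Fin n) ℝ} {γx : ℝ} {Q P₁ : Matrix (Fin n) (Fin n) ℝ}
  {P₂ : Matrix (Fin q) (Fin q) ℝ}

theorem norm_sq_eq_x_e (z : Pair n q) : ‖z‖ ^ 2 = ‖z.x‖ ^ 2 + ‖z.e‖ ^ 2 := by
  simp [EuclideanSpace.norm_sq_eq, Pair.x, Pair.e]

/-- The error field as a continuous linear map. -/
noncomputable def errorCLM (A : Matrix (Fin n) (Fin n) ℝ) (B : Matrix (Fin n) (Fin q) ℝ)
    (C : Matrix (Fin q) (Fin n) ℝ) : Pair n q →L[ℝ] Pair n q :=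
  toEuclideanCLM (𝕜 := ℝ) (errorMatrix A B C)

/-- The matrix of the Lyapunov function as a continuous linear map. -/
noncomputable def lyapCLM (P₁ : Matrix (Fin n) (Fin n) ℝ) (P₂ : Matrix (Fin q) (Fin q) ℝ) :
    Pair n q →L[ℝ] Pair n q :=
  toEuclideanCLM (𝕜 := ℝ) (blockP P₁ P₂)

theorem lyapV_eq (z : Pair n q) :
    lyapV P₁ P₂ z = (1 / 2) * inner ℝ z (lyapCLM P₁ P₂ z) := by
  rw [lyapCLM, inner_toEuclideanCLM]; rfl

theorem inner_lyapCLM_comm (hP : (blockP P₁ P₂).IsHermitian) (z w : Pair n q) :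
    inner ℝ z (lyapCLM P₁ P₂ w) = inner ℝ w (lyapCLM P₁ P₂ z) := by
  rw [lyapCLM, inner_toEuclideanCLM, inner_toEuclideanCLM, dotProduct_mulVec,
    ← mulVec_transpose, dotProduct_comm]
  have : (blockP P₁ P₂)ᵀ = blockP P₁ P₂ := by
    simpa [Matrix.IsHermitian, conjTranspose_eq_transpose_of_trivial] using hP
  rw [this]

theorem hasGradientAt_lyapV (hP : (blockP P₁ P₂).IsHermitian) (z : Pair n q) :
    HasGradientAt (lyapV P₁ P₂) (lyapCLM P₁ P₂ z) z := by
  rw [hasGradientAt_iff_hasFDerivAt]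
  have h := (((hasFDerivAt_id z).inner ℝ (lyapCLM P₁ P₂).hasFDerivAt)).const_mul (1 / 2 : ℝ)
  have hV : lyapV P₁ P₂ = fun z => (1 / 2) * inner ℝ z (lyapCLM P₁ P₂ z) := funext lyapV_eq
  rw [hV]
  refine h.congr_fderiv ?_
  ext w
  have h1 : inner ℝ (lyapCLM P₁ P₂ z) w = inner ℝ z (lyapCLM P₁ P₂ w) := by
    rw [real_inner_comm, inner_lyapCLM_comm hP]
  simp [fderivInnerCLM_apply, inner_lyapCLM_comm hP w z, h1]
  ring

/-- The derivative of the Lyapunov function along the error dynamics. -/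
noncomputable def lyapRate (A : Matrix (Fin n) (Fin n) ℝ) (B : Matrix (Fin n) (Fin q) ℝ)
    (C : Matrix (Fin q) (Fin n) ℝ) (P₁ : Matrix (Fin n) (Fin n) ℝ)
    (P₂ : Matrix (Fin q) (Fin q) ℝ) (z : Pair n q) : ℝ :=
  inner ℝ (lyapCLM P₁ P₂ z) (errorCLM A B C z)

theorem inner_gradient_eq_lyapRate (hP : (blockP P₁ P₂).IsHermitian) (z : Pair n q) :
    inner ℝ (∇ (lyapV P₁ P₂) z) (errorField A B C z) = lyapRate A B C P₁ P₂ z := by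
  rw [(hasGradientAt_lyapV hP z).gradient]; rfl

theorem hasDerivWithinAt_lyapV (hP : (blockP P₁ P₂).IsHermitian) {z : ℝ → Pair n q} {s : Set ℝ}
    {t : ℝ} (hz : HasDerivWithinAt z (errorField A B C (z t)) s t) :
    HasDerivWithinAt (fun r => lyapV P₁ P₂ (z r)) (lyapRate A B C P₁ P₂ (z t)) s t := by
  have := (hasGradientAt_iff_hasFDerivAt.1 (hasGradientAt_lyapV hP (z t))).comp_hasDerivWithinAt t hz
  simpa using! this

/-- Bilinearity writes the difference of the rates as `⟨P(z - w), Fz⟩ + ⟨Pw, F(z - w)⟩`. This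
transfers the negative rate at a post-jump point to nearby points. -/
theorem lyapRate_sub_le (z w : Pair n q) :
    lyapRate A B C P₁ P₂ z ≤ lyapRate A B C P₁ P₂ w +
      ‖lyapCLM P₁ P₂‖ * ‖errorCLM A B C‖ * (‖z - w‖ * (‖z‖ + ‖w‖)) := by
  set P := lyapCLM P₁ P₂
  set F := errorCLM A B C
  have h1 : lyapRate A B C P₁ P₂ z - lyapRate A B C P₁ P₂ w =
      inner ℝ (P (z - w)) (F z) + inner ℝ (P w) (F (z - w)) := by
    simp only [lyapRate, map_sub, inner_sub_left, inner_sub_right, P, F]; ring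
  have h2 : inner ℝ (P (z - w)) (F z) ≤ (‖P‖ * ‖z - w‖) * (‖F‖ * ‖z‖) :=
    (real_inner_le_norm _ _).trans (by gcongr <;> exact ContinuousLinearMap.le_opNorm _ _)
  have h3 : inner ℝ (P w) (F (z - w)) ≤ (‖P‖ * ‖w‖) * (‖F‖ * ‖z - w‖) :=
    (real_inner_le_norm _ _).trans (by gcongr <;> exact ContinuousLinearMap.le_opNorm _ _)
  linarith

theorem lyapRate_le (z : Pair n q) :
    lyapRate A B C P₁ P₂ z ≤ ‖lyapCLM P₁ P₂‖ * ‖errorCLM A B C‖ * ‖z‖ ^ 2 := by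
  have := lyapRate_sub_le (A := A) (B := B) (C := C) (P₁ := P₁) (P₂ := P₂) z 0
  simp only [lyapRate, map_zero, inner_zero_left, sub_zero, norm_zero, add_zero, zero_add]
    at this ⊢
  linarith

theorem continuous_lyapRate : Continuous (lyapRate A B C P₁ P₂) := by
  unfold lyapRate; fun_prop

/-- The value of the pair `(x, e)` after a transmission. -/
def Pair.reset (z : Pair n q) : Pair n q := WithLp.toLp 2 (Sum.elim z.x.ofLp 0)

theorem Pair.reset_e (z : Pair n q) : z.reset.e = 0 := by
  ext i; simp [Pair.reset, Pair.e]

theorem Pair.x_reset (z : Pair n q) : z.reset.x = z.x := by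
  ext i; simp [Pair.reset, Pair.x]

theorem lyapV_eq_blocks (z : Pair n q) :
    lyapV P₁ P₂ z = (1 / 2) * (z.x.ofLp ⬝ᵥ (P₁ *ᵥ z.x.ofLp) + z.e.ofLp ⬝ᵥ (P₂ *ᵥ z.e.ofLp)) := by
  have : z.ofLp = Sum.elim z.x.ofLp z.e.ofLp := by
    ext (i | i) <;> simp [Pair.x, Pair.e]
  rw [lyapV, this, blockP, fromBlocks_mulVec]
  simp

theorem CondS1.lyapV_reset_le (h : CondS1 A B C γx Q P₁ P₂) (z : Pair n q) :
    lyapV P₁ P₂ z.reset ≤ lyapV P₁ P₂ z := by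
  rw [lyapV_eq_blocks, lyapV_eq_blocks z, Pair.reset_e, Pair.x_reset]
  -- Testing `P` on `(0, e)` shows that the term dropped by the reset is nonnegative.
  have h1 := (posSemidef_iff_dotProduct_mulVec.1 h.P_posDef.posSemidef).2 (Sum.elim 0 z.e.ofLp)
  rw [blockP, fromBlocks_mulVec] at h1
  simp at h1 ⊢
  linarith

/-- With `e = 0` the rate is half of `xᵀ(MᵀP₁ + P₁M)x` for `M = A + BC`. This is at most `-½ xᵀQx`,
and `γx I < Q` finishes the bound. -/
theorem CondS1.lyapRate_le_of_e_eq_zero (h : CondS1 A B C γx Q P₁ P₂) {z : Pair n q}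
    (hz : z.e = 0) : lyapRate A B C P₁ P₂ z ≤ -(γx / 2) * ‖z‖ ^ 2 := by
  have hzx : z.ofLp = Sum.elim z.x.ofLp 0 := by
    ext (i | i)
    · simp [Pair.x]
    · simpa [Pair.e] using congrArg (fun v : EuclideanSpace ℝ (Fin q) => v i) hz
  have hP₁ : P₁ᵀ = P₁ := by
    have := h.P_posDef.isHermitian
    rw [blockP, Matrix.isHermitian_fromBlocks_iff] at this
    simpa [Matrix.IsHermitian, conjTranspose_eq_transpose_of_trivial] using this.1
  set x := z.x.ofLp with hx
  obtain ⟨M, hM⟩ : ∃ M, M = A + B * C := ⟨_, rfl⟩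
  have h1 : lyapRate A B C P₁ P₂ z = (P₁ *ᵥ x) ⬝ᵥ (M *ᵥ x) := by
    rw [lyapRate, real_inner_comm, EuclideanSpace.inner_eq_star_dotProduct]
    simp only [lyapCLM, errorCLM, ofLp_toEuclideanCLM, hzx, blockP, errorMatrix,
      fromBlocks_mulVec, ← hM]
    simp [dotProduct_comm]
  have h2 := (posSemidef_iff_dotProduct_mulVec.1 h.lyap).2 x
  rw [← hM] at h2
  have h3 := (posSemidef_iff_dotProduct_mulVec.1 h.γx_lt.posSemidef).2 x
  have h4 : ‖z‖ ^ 2 = x ⬝ᵥ x := by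
    rw [norm_sq_eq_x_e, hz, EuclideanSpace.norm_sq_eq]
    simp [dotProduct, hx, sq]
  have h5 : x ⬝ᵥ (Mᵀ * P₁) *ᵥ x = (P₁ *ᵥ x) ⬝ᵥ (M *ᵥ x) := by
    rw [← mulVec_mulVec, dotProduct_mulVec, vecMul_transpose, dotProduct_comm]
  have h6 : x ⬝ᵥ (P₁ * M) *ᵥ x = (P₁ *ᵥ x) ⬝ᵥ (M *ᵥ x) := by
    rw [← mulVec_mulVec, dotProduct_mulVec, ← mulVec_transpose, hP₁]
  simp only [star_trivial, sub_mulVec, dotProduct_sub, add_mulVec, dotProduct_add, neg_mulVec,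
    dotProduct_neg, smul_mulVec, one_mulVec, dotProduct_smul, smul_eq_mul] at h2 h3
  rw [h5, h6] at h2
  rw [h1, h4]
  linarith

end Lyapunov

/-! ### Growth and decay of the Lyapunov function along flows -/

section Decay

variable {n q : ℕ} {A : Matrix (Fin n) (Fin n) ℝ} {B : Matrix (Fin n) (Fin q) ℝ}
  {C : Matrix (Fin q) (Fin n) ℝ} {γx γe : ℝ} {Q P₁ : Matrix (Fin n) (Fin n) ℝ}
  {P₂ : Matrix (Fin q) (Fin q) ℝ}

theorem CondS1.exists_lyapV_bounds (h : CondS1 A B C γx Q P₁ P₂) :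
    ∃ p > 0, ∃ p' > 0, ∀ z : Pair n q, p * ‖z‖ ^ 2 ≤ lyapV P₁ P₂ z ∧
      lyapV P₁ P₂ z ≤ p' * ‖z‖ ^ 2 := by
  obtain ⟨p, hp, hpz⟩ := exists_pos_mul_sq_le_inner (lyapCLM P₁ P₂) fun z hz => by
    rw [lyapCLM, inner_toEuclideanCLM]
    simpa using (posDef_iff_dotProduct_mulVec.1 h.P_posDef).2 (x := z.ofLp) (by simpa using hz)
  refine ⟨p / 2, by positivity, ‖lyapCLM P₁ P₂‖ + 1, by positivity, fun z => ?_⟩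
  rw [lyapV_eq]
  have h1 : inner ℝ z (lyapCLM P₁ P₂ z) ≤ ‖z‖ * (‖lyapCLM P₁ P₂‖ * ‖z‖) :=
    (real_inner_le_norm _ _).trans (by gcongr; exact ContinuousLinearMap.le_opNorm _ _)
  have h2 := hpz z
  have h3 : 0 ≤ ‖lyapCLM P₁ P₂‖ * ‖z‖ ^ 2 := by positivity
  constructor
  · linarith
  · nlinarith [sq_nonneg ‖z‖]

/-- Trajectories of the linear error dynamics stay close to their initial value. -/
theorem norm_sub_le_of_errorField {z : ℝ → Pair n q} {a b L : ℝ} (hL : 0 < L)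
    (hLF : ‖errorCLM A B C‖ ≤ L)
    (hz : ∀ t ∈ Icc a b, HasDerivWithinAt z (errorField A B C (z t)) (Icc a b) t) :
    ∀ t ∈ Icc a b, ‖z t - z a‖ ≤ (Real.exp (L * (t - a)) - 1) * ‖z a‖ := by
  intro t ht
  have h := norm_le_gronwallBound_of_norm_deriv_right_le (f := fun t => z t - z a)
    (f' := fun t => errorField A B C (z t)) (δ := 0) (K := L) (ε := L * ‖z a‖) (a := a) (b := b)
    (fun t ht => ((hz t ht).sub_const _).continuousWithinAt)
    (fun t ht => ((hz t (Ico_subset_Icc_self ht)).sub_const _).mono_of_mem_nhdsWithin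
      (Icc_mem_nhdsGE_of_mem ht)) (by simp) (fun t ht => by
      have h1 : ‖errorField A B C (z t)‖ ≤ L * ‖z t‖ :=
        (ContinuousLinearMap.le_opNorm (errorCLM A B C) _).trans (by gcongr)
      have h2 : ‖z t‖ ≤ ‖z t - z a‖ + ‖z a‖ := by simpa using norm_add_le (z t - z a) (z a)
      calc _ ≤ L * ‖z t‖ := h1
        _ ≤ L * (‖z t - z a‖ + ‖z a‖) := by gcongr
        _ = _ := by ring) t ht
  rw [gronwallBound_of_K_ne_0 hL.ne'] at h
  refine h.trans_eq ?_
  field_simp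
  ring

/-- A crude bound for the initial phase, where `e` need not vanish and the timer may force flow
outside the flow pairs. -/
theorem CondS1.exists_growth (h : CondS1 A B C γx Q P₁ P₂) :
    ∃ K > 0, ∀ (z : ℝ → Pair n q) (a b : ℝ), a ≤ b →
      (∀ t ∈ Icc a b, HasDerivWithinAt z (errorField A B C (z t)) (Icc a b) t) →
      lyapV P₁ P₂ (z b) ≤ Real.exp (K * (b - a)) * lyapV P₁ P₂ (z a) := by
  obtain ⟨p, hp, p', hp', hV⟩ := h.exists_lyapV_bounds
  set M := ‖lyapCLM P₁ P₂‖ * ‖errorCLM A B C‖ with hM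
  refine ⟨(M + 1) / p, by positivity, fun z a b hab hz => ?_⟩
  have := le_exp_mul_of_hasDerivWithinAt (c := -((M + 1) / p)) hab
    (fun t ht => hasDerivWithinAt_lyapV h.P_posDef.isHermitian (hz t ht)) fun t ht => by
      rw [neg_neg]
      calc lyapRate A B C P₁ P₂ (z t) ≤ M * ‖z t‖ ^ 2 := lyapRate_le _
        _ ≤ (M + 1) * ‖z t‖ ^ 2 := by gcongr; linarith
        _ = (M + 1) / p * (p * ‖z t‖ ^ 2) := by field_simp
        _ ≤ _ := by gcongr; exact (hV _).1
  simpa using this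

/-- Two regimes give decay at one common rate: flow pairs, by their defining inequalities, and a
short time after a point with `e = 0`, by perturbation from that point. -/
theorem CondS1.exists_decay (h : CondS1 A B C γx Q P₁ P₂) (hγe : 0 < γe) :
    ∃ c > 0, ∃ ρ₀ > 0, ∀ (z : ℝ → Pair n q) (a b : ℝ), a ≤ b →
      (∀ t ∈ Icc a b, HasDerivWithinAt z (errorField A B C (z t)) (Icc a b) t) →
      (∀ t ∈ Ioo a b, z t ∈ flowPairs A B C γx γe P₁ P₂ ∨ ((z a).e = 0 ∧ t - a < ρ₀)) →
      lyapV P₁ P₂ (z b) ≤ Real.exp (-c * (b - a)) * lyapV P₁ P₂ (z a) := by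
  obtain ⟨p, hp, p', hp', hV⟩ := h.exists_lyapV_bounds
  have hγx := h.γx_pos
  set L := ‖errorCLM A B C‖ + 1 with hL
  have hL0 : 0 < L := by positivity
  set M := ‖lyapCLM P₁ P₂‖ * ‖errorCLM A B C‖ with hM
  have hM0 : 0 ≤ M := by positivity
  -- The relative displacement allowed during the short phase. Then `‖z t‖ + ‖z a‖ ≤ 3 ‖z a‖`, and
  -- the perturbation `3Mη` uses at most half of the available `γx / 2`.
  set η := min 1 (γx / (12 * (M + 1))) with hη
  have hη0 : 0 < η := lt_min one_pos (by positivity)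
  have hη1 : η ≤ 1 := min_le_left _ _
  have hηM : M * η * 3 ≤ γx / 4 := by
    calc M * η * 3 ≤ (M + 1) * (γx / (12 * (M + 1))) * 3 := by
          gcongr
          · linarith
          · exact min_le_right _ _
      _ = _ := by field_simp; norm_num
  -- The first entry serves the short phase, where `γx / 4` is left and `‖z t‖² ≤ 4 ‖z a‖²`. The
  -- second serves the flow pairs, where `‖z‖² ≤ (1 + γe²) ‖x‖²`.
  set c₀ := min (γx / 16) (γx / (1 + γe ^ 2)) with hc₀
  have hc₀0 : 0 < c₀ := lt_min (by positivity) (by positivity)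
  -- The time bound is the one for which `exp (L (t - a)) - 1` stays at most `η`.
  refine ⟨c₀ / p', by positivity, Real.log (1 + η) / L,
    div_pos (Real.log_pos (by linarith)) hL0, fun z a b hab hz hcase => ?_⟩
  refine le_exp_mul_of_hasDerivWithinAt hab
    (fun t ht => hasDerivWithinAt_lyapV h.P_posDef.isHermitian (hz t ht)) fun t ht => ?_
  have key : lyapRate A B C P₁ P₂ (z t) ≤ -c₀ * ‖z t‖ ^ 2 := by
    rcases hcase t ht with hC | ⟨he, hta⟩
    · rw [flowPairs, mem_ofPred_eq, inner_gradient_eq_lyapRate h.P_posDef.isHermitian] at hC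
      obtain ⟨h1, h2⟩ := hC
      have h3 : ‖z t‖ ^ 2 ≤ (1 + γe ^ 2) * ‖(z t).x‖ ^ 2 := by
        rw [norm_sq_eq_x_e]
        have : ‖(z t).e‖ ^ 2 ≤ (γe * ‖(z t).x‖) ^ 2 := by gcongr
        linarith
      have h4 : c₀ * ‖z t‖ ^ 2 ≤ γx * ‖(z t).x‖ ^ 2 := by
        calc c₀ * ‖z t‖ ^ 2 ≤ γx / (1 + γe ^ 2) * ((1 + γe ^ 2) * ‖(z t).x‖ ^ 2) := by
              gcongr; exact min_le_right _ _
          _ = _ := by field_simp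
      linarith
    · have hexp : Real.exp (L * (t - a)) - 1 ≤ η := by
        have h1 : L * (t - a) ≤ Real.log (1 + η) := by
          rw [lt_div_iff₀ hL0] at hta; linarith
        have h2 := Real.exp_le_exp.2 h1
        rw [Real.exp_log (by linarith)] at h2
        linarith
      have hd : ‖z t - z a‖ ≤ η * ‖z a‖ :=
        (norm_sub_le_of_errorField hL0 (by linarith) hz t (Ioo_subset_Icc_self ht)).trans
          (by gcongr)
      have hn : ‖z t‖ ≤ 2 * ‖z a‖ := by
        have h2 : ‖z t‖ ≤ ‖z t - z a‖ + ‖z a‖ := by simpa using norm_add_le (z t - z a) (z a)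
        nlinarith [norm_nonneg (z a)]
      have h1 := lyapRate_sub_le (A := A) (B := B) (C := C) (P₁ := P₁) (P₂ := P₂) (z t) (z a)
      have h2 := h.lyapRate_le_of_e_eq_zero he
      have h3 : M * (‖z t - z a‖ * (‖z t‖ + ‖z a‖)) ≤ γx / 4 * ‖z a‖ ^ 2 := by
        calc _ ≤ M * ((η * ‖z a‖) * (2 * ‖z a‖ + ‖z a‖)) := by gcongr
          _ = M * η * 3 * ‖z a‖ ^ 2 := by ring
          _ ≤ _ := by gcongr
      have h4 : c₀ * ‖z t‖ ^ 2 ≤ γx / 4 * ‖z a‖ ^ 2 := by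
        calc c₀ * ‖z t‖ ^ 2 ≤ γx / 16 * (2 * ‖z a‖) ^ 2 := by gcongr; exact min_le_left _ _
          _ = _ := by ring
      linarith
  have h5 : c₀ / p' * lyapV P₁ P₂ (z t) ≤ c₀ * ‖z t‖ ^ 2 := by
    calc _ ≤ c₀ / p' * (p' * ‖z t‖ ^ 2) := by gcongr; exact (hV _).2
      _ = _ := by field_simp
  linarith

end Decay

/-! ### Flow of the closed loop and distance to the target set -/

section Loop

variable {n q : ℕ} {A : Matrix (Fin n) (Fin n) ℝ} {B : Matrix (Fin n) (Fin q) ℝ}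
  {C : Matrix (Fin q) (Fin n) ℝ} {Cbar Dbar : Set (Pair n q)} {Δ ρ : ℝ}

/-- The single-valued flow map of the synchronous closed loop. -/
noncomputable def flowField (A : Matrix (Fin n) (Fin n) ℝ) (B : Matrix (Fin n) (Fin q) ℝ)
    (C : Matrix (Fin q) (Fin n) ℝ) (ρ : ℝ) (X : State n q) : State n q :=
  WithLp.toLp 2 (errorField A B C X.fst, 1 - deadzone (X.snd / ρ))

theorem continuous_fst : Continuous fun X : State n q => X.fst :=
  (WithLp.fstL 2 ℝ (Pair n q) ℝ).continuous

theorem continuous_snd : Continuous fun X : State n q => X.snd :=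
  (WithLp.sndL 2 ℝ (Pair n q) ℝ).continuous

theorem continuous_flowField : Continuous (flowField A B C ρ) := by
  have h1 : Continuous fun X : State n q => errorField A B C X.fst :=
    (errorCLM A B C).continuous.comp continuous_fst
  have h2 : Continuous fun X : State n q => 1 - deadzone (X.snd / ρ) :=
    continuous_const.sub (continuous_deadzone.comp (continuous_snd.div_const ρ))
  exact (WithLp.prod_continuous_toLp 2 (Pair n q) ℝ).comp (h1.prodMk h2)

/-- A shortcut: the search for this instance is slow. -/
instance : ContinuousSMul ℝ (State n q) := IsBoundedSMul.continuousSMul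

theorem hasDerivAt_toLp {z : ℝ → Pair n q} {τ : ℝ → ℝ} {z' : Pair n q} {τ' : ℝ} {t : ℝ}
    (hz : HasDerivAt z z' t) (hτ : HasDerivAt τ τ' t) :
    HasDerivAt (fun r => (WithLp.toLp 2 (z r, τ r) : State n q)) (WithLp.toLp 2 (z', τ')) t := by
  let e := ((WithLp.prodContinuousLinearEquiv 2 ℝ (Pair n q) ℝ).symm :
    Pair n q × ℝ →L[ℝ] State n q)
  have he : ∀ p, e p = WithLp.toLp 2 p := fun _ => rfl
  have h := (e.hasFDerivAt (x := (z t, τ t))).comp_hasDerivAt t (hz.prodMk hτ)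
  simpa only [Function.comp_def, he] using h

theorem syncLoop_snd_nonneg_of_mem_closure {X : State n q} (hΔ : 0 < Δ)
    (hX : X ∈ closure (syncLoop A B C Cbar Dbar Δ ρ).C ∪ (syncLoop A B C Cbar Dbar Δ ρ).D) :
    0 ≤ X.snd := by
  rcases hX with h | h
  · exact closure_minimal (t := {X : State n q | 0 ≤ X.snd}) (fun X hX => hX.1)
      (isClosed_le continuous_const continuous_snd) h
  · exact hΔ.le.trans h.2

theorem syncLoop_flow {x : HybridArc (State n q)}
    (hx : (syncLoop A B C Cbar Dbar Δ ρ).IsSolution x) {j : ℕ} {a b : ℝ} (hab : a ≤ b)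
    (hsub : Icc a b ⊆ x.slice j) (h0 : 0 ≤ (x.val a j).snd) :
    (∀ t ∈ Icc a b, HasDerivWithinAt (fun s => (x.val s j).fst)
      (errorField A B C (x.val t j).fst) (Icc a b) t) ∧
    (∀ t ∈ Icc a b, HasDerivWithinAt (fun s => (x.val s j).snd)
      (1 - deadzone ((x.val t j).snd / ρ)) (Icc a b) t) ∧
    (∀ t ∈ Icc a b, 0 ≤ (x.val t j).snd) ∧
    ∀ t ∈ Ioo a b, (x.val t j).fst ∈ Cbar ∨ (x.val t j).snd ≤ Δ := by
  -- A degenerate interval carries no flow condition, so there the sign of the timer comes from `h0`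
  -- alone. On a proper interval it comes from the flow set, and by continuity at `b`.
  rcases hab.eq_or_lt with rfl | hab
  · have hs : ∀ t ∈ Icc a a, t = a := fun t ht => by simpa using ht
    refine ⟨fun t ht => ?_, fun t ht => ?_, fun t ht => ?_, fun t ht => ?_⟩
    · exact HasFDerivWithinAt.of_subsingleton (by simp)
    · exact HasFDerivWithinAt.of_subsingleton (by simp)
    · rwa [hs t ht]
    · simp at ht
  · obtain ⟨h1, h2⟩ := hx.hasDerivWithinAt (continuous_flowField (A := A) (B := B) (C := C)
      (ρ := ρ)) (fun ξ => rfl) hab hsub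
    have hf : ∀ t ∈ Icc a b, HasDerivWithinAt (fun s => (x.val s j).snd)
        (1 - deadzone ((x.val t j).snd / ρ)) (Icc a b) t := fun t ht =>
      (WithLp.sndL 2 ℝ (Pair n q) ℝ).hasFDerivAt.comp_hasDerivWithinAt t (h1 t ht)
    refine ⟨fun t ht => (WithLp.fstL 2 ℝ (Pair n q) ℝ).hasFDerivAt.comp_hasDerivWithinAt t
      (h1 t ht), hf, ?_, fun t ht => (h2 t (Ioo_subset_Ico_self ht)).2⟩
    have hcont : ContinuousOn (fun s => (x.val s j).snd) (Icc a b) :=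
      fun t ht => (hf t ht).continuousWithinAt
    have hcl : closure (Ico a b) = Icc a b := closure_Ico hab.ne
    intro t ht
    have := hcont.mono hcl.subset
    rw [← hcl] at ht
    exact le_on_closure (f := fun _ => (0 : ℝ)) (fun s hs => (h2 s hs).1) continuousOn_const this ht

/-- For a nonnegative timer the nearest point of the target is `(0, min τ (2ρ))`. -/
theorem infDist_targetSet_sq (hρ : 0 < ρ) {X : State n q} (hX : 0 ≤ X.snd) :
    Metric.infDist X (targetSet n q ρ) ^ 2 = ‖X.fst‖ ^ 2 + max 0 (X.snd - 2 * ρ) ^ 2 := by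
  have hmem : (WithLp.toLp 2 (0, min X.snd (2 * ρ)) : State n q) ∈ targetSet n q ρ :=
    ⟨rfl, le_min hX (by positivity), min_le_right _ _⟩
  have hm : X.snd - min X.snd (2 * ρ) = max 0 (X.snd - 2 * ρ) := by
    rcases le_total X.snd (2 * ρ) with h | h
    · rw [min_eq_left h, max_eq_left (by linarith), sub_self]
    · rw [min_eq_right h, max_eq_right (by linarith)]
  have hd : Metric.infDist X (targetSet n q ρ) =
      Real.sqrt (‖X.fst‖ ^ 2 + max 0 (X.snd - 2 * ρ) ^ 2) := by
    apply le_antisymm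
    · refine (Metric.infDist_le_dist_of_mem hmem).trans_eq ?_
      rw [WithLp.prod_dist_eq_of_L2]
      simp [Real.dist_eq, hm]
    · refine (Metric.le_infDist ⟨_, hmem⟩).2 fun {Y} hY => ?_
      rw [WithLp.prod_dist_eq_of_L2]
      obtain ⟨hY1, hY2⟩ := hY
      rw [hY1, dist_zero_right]
      gcongr
      rw [Real.dist_eq]
      refine max_le (abs_nonneg _) (le_trans ?_ (le_abs_self _))
      linarith [hY2.2]
  rw [hd, Real.sq_sqrt (by positivity)]

theorem isCompact_targetSet : IsCompact (targetSet n q ρ) := by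
  have h : targetSet n q ρ =
      (fun τ : ℝ => (WithLp.toLp 2 (0, τ) : State n q)) '' Icc 0 (2 * ρ) := by
    ext X
    constructor
    · rintro ⟨h1, h2⟩
      refine ⟨X.snd, h2, ?_⟩
      rw [← h1]; rfl
    · rintro ⟨τ, hτ, rfl⟩
      exact ⟨rfl, hτ⟩
  rw [h]
  refine isCompact_Icc.image ?_
  exact (WithLp.prod_continuous_toLp 2 _ _).comp (continuous_const.prodMk continuous_id)

end Loop

/-! ### A priori estimates in hybrid time -/

section Apriori

variable {n q : ℕ} {A : Matrix (Fin n) (Fin n) ℝ} {B : Matrix (Fin n) (Fin q) ℝ}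
  {C : Matrix (Fin q) (Fin n) ℝ} {γx γe : ℝ} {Q P₁ : Matrix (Fin n) (Fin n) ℝ}
  {P₂ : Matrix (Fin q) (Fin q) ℝ}

/-- All estimates are proved in one induction on `j`. The factor `exp ((K + c) Δ)` is the price of
growing at rate `K`, instead of decaying at rate `c`, during an initial time at most `Δ`. The
initial timer is arbitrary, so the first jump may come at once. Hence the `j - 1`, and the timer
counts in the last bound only from `j = 1` on. -/
theorem CondS1.exists_lyapV_decay (h : CondS1 A B C γx Q P₁ P₂) (hγe : 0 < γe) :
    ∃ c > 0, ∃ K > 0, ∃ ρ₀ > 0, ∀ ρ Δ : ℝ, 0 < Δ → Δ < ρ → ρ < ρ₀ →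
      ∀ x, (syncLoop A B C (flowPairs A B C γx γe P₁ P₂) (jumpPairs A B C γx γe P₁ P₂)
        Δ ρ).IsSolution x → ∀ (j : ℕ) (s : ℝ), (s, j) ∈ x.dom →
      0 ≤ (x.val s j).snd ∧
      lyapV P₁ P₂ (x.val s j).fst ≤
        Real.exp ((K + c) * Δ) * Real.exp (-c * s) * lyapV P₁ P₂ (x.val 0 0).fst ∧
      max 0 ((x.val s j).snd - 2 * ρ) ≤
        Real.exp (-(1 / ρ) * s) * max 0 ((x.val 0 0).snd - 2 * ρ) ∧
      ((j : ℝ) - 1) * Δ + (if j = 0 then 0 else (x.val s j).snd) ≤ s := by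
  obtain ⟨c, hc, ρ₀, hρ₀, hdecay⟩ := h.exists_decay hγe
  obtain ⟨K, hK, hgrowth⟩ := h.exists_growth
  obtain ⟨p, hp, p', hp', hVb⟩ := h.exists_lyapV_bounds
  have hVnn : ∀ z, 0 ≤ lyapV P₁ P₂ z := fun z =>
    (by positivity : 0 ≤ p * ‖z‖ ^ 2).trans (hVb z).1
  refine ⟨c, hc, K, hK, ρ₀, hρ₀, fun ρ Δ hΔ hΔρ hρ x hx j => ?_⟩
  have hρ0 : 0 < ρ := hΔ.trans hΔρ
  induction j with
  | zero =>
    intro s hs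
    have hs0 := x.nonneg_of_mem_dom hs
    have hsub : Icc 0 s ⊆ x.slice 0 := (x.slice_ordConnected 0).out x.zero_mem_dom hs
    have hinit := syncLoop_snd_nonneg_of_mem_closure hΔ hx.init
    obtain ⟨hz, hτ, hτ0, hC⟩ := syncLoop_flow hx hs0 hsub hinit
    refine ⟨hτ0 s ⟨hs0, le_rfl⟩, ?_, by simpa using timer_excess_le hρ0 hs0 hτ, ?_⟩
    · have hV := hVnn (x.val 0 0).fst
      rcases le_total s Δ with hsΔ | hsΔ
      · have h1 := hgrowth _ 0 s hs0 hz
        rw [sub_zero] at h1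
        refine h1.trans (mul_le_mul_of_nonneg_right ?_ hV)
        rw [← Real.exp_add, Real.exp_le_exp]
        nlinarith
      · have hsub1 : Icc 0 Δ ⊆ Icc 0 s := Icc_subset_Icc_right hsΔ
        have hsub2 : Icc Δ s ⊆ Icc 0 s := Icc_subset_Icc_left hΔ.le
        have h1 := hgrowth _ 0 Δ hΔ.le fun t ht => (hz t (hsub1 ht)).mono hsub1
        have h2 := hdecay _ Δ s hsΔ (fun t ht => (hz t (hsub2 ht)).mono hsub2) fun t ht => by
          left
          -- After time `Δ` the timer alternative is impossible: a reading at most `Δ` would force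
          -- the elapsed time to be at most `Δ`.
          refine (hC t ⟨hΔ.trans ht.1, ht.2⟩).resolve_right fun hle => ?_
          have ht0 : 0 ≤ t := hΔ.le.trans ht.1.le
          have hsub3 : Icc 0 t ⊆ Icc 0 s := Icc_subset_Icc_right ht.2.le
          have h3 := le_timer_sub hρ0 ht0 (fun r hr => (hτ r (hsub3 hr)).mono hsub3)
            (fun r hr => hτ0 r (hsub3 hr)) hΔρ hle
          linarith [ht.1]
        calc _ ≤ _ := h2
          _ ≤ Real.exp (-c * (s - Δ)) * (Real.exp (K * (Δ - 0)) *
              lyapV P₁ P₂ (x.val 0 0).fst) := by gcongr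
          _ = _ := by
            rw [← mul_assoc, ← Real.exp_add, ← Real.exp_add]; congr 2; ring
    · simp; linarith
  | succ j ih =>
    intro s hs
    obtain ⟨a, has, haj, haj'⟩ := x.exists_jump_time hs
    obtain ⟨ih1, ih2, ih3, ih4⟩ := ih a haj
    obtain ⟨hD, hG⟩ := hx.jump a j haj haj'
    have hG' : x.val a (j + 1) = WithLp.toLp 2 ((x.val a j).fst.reset, 0) := hG
    have hfst : (x.val a (j + 1)).fst = (x.val a j).fst.reset := congrArg WithLp.fst hG'
    have hsnd : (x.val a (j + 1)).snd = 0 := congrArg WithLp.snd hG'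
    have hsub : Icc a s ⊆ x.slice (j + 1) := (x.slice_ordConnected (j + 1)).out haj' hs
    obtain ⟨hz, hτ, hτ0, hC⟩ := syncLoop_flow hx has hsub hsnd.ge
    refine ⟨hτ0 s ⟨has, le_rfl⟩, ?_, ?_, ?_⟩
    · have h1 := hdecay _ a s has hz fun t ht => by
        -- If the timer is what permits the flow, then `t - a ≤ Δ < ρ₀`, so the short-time regime
        -- after a reset applies.
        refine (hC t ht).imp_right fun hle => ⟨by rw [hfst, Pair.reset_e], ?_⟩
        have hsub3 : Icc a t ⊆ Icc a s := Icc_subset_Icc_right ht.2.le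
        have h3 := le_timer_sub hρ0 ht.1.le (fun r hr => (hτ r (hsub3 hr)).mono hsub3)
          (fun r hr => hτ0 r (hsub3 hr)) hΔρ hle
        linarith
      have h2 := h.lyapV_reset_le (x.val a j).fst
      rw [← hfst] at h2
      calc _ ≤ _ := h1
        _ ≤ Real.exp (-c * (s - a)) * (Real.exp ((K + c) * Δ) * Real.exp (-c * a) *
            lyapV P₁ P₂ (x.val 0 0).fst) := by gcongr; exact h2.trans ih2
        _ = _ := by
          rw [← mul_assoc, ← Real.exp_add, ← Real.exp_add, ← Real.exp_add]; congr 2; ring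
    · have h1 := timer_excess_le hρ0 has hτ
      have h5 : max 0 (0 - 2 * ρ) = 0 := max_eq_left (by linarith)
      rw [hsnd, h5, mul_zero] at h1
      exact h1.trans (by positivity)
    · have h1 := timer_sub_le hρ0 has hτ hτ0
      rw [hsnd, sub_zero] at h1
      simp only [Nat.add_eq_zero_iff, one_ne_zero, and_false, if_false]
      push_cast
      -- The first jump contributes only a nonnegative time. Every later one finds the timer at
      -- least at `Δ`, which adds `Δ` to the bound.
      by_cases hj : j = 0
      · subst hj
        have := x.nonneg_of_mem_dom haj
        simp; linarith
      · rw [if_neg hj] at ih4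
        have : Δ ≤ (x.val a j).snd := hD.2
        linarith

theorem CondS1.exists_isExpStable (h : CondS1 A B C γx Q P₁ P₂) (hγe : 0 < γe) :
    ∃ ρ₀ > 0, ∀ ρ Δ : ℝ, 0 < Δ → Δ < ρ → ρ < ρ₀ →
      (syncLoop A B C (flowPairs A B C γx γe P₁ P₂) (jumpPairs A B C γx γe P₁ P₂)
        Δ ρ).IsExpStable (targetSet n q ρ) := by
  obtain ⟨c, hc, K, hK, ρ₀, hρ₀, hmain⟩ := h.exists_lyapV_decay hγe
  obtain ⟨p, hp, p', hp', hVb⟩ := h.exists_lyapV_bounds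
  refine ⟨ρ₀, hρ₀, fun ρ Δ hΔ hΔρ hρ => ?_⟩
  have hρ0 : 0 < ρ := hΔ.trans hΔρ
  -- Everything is compared in squares: `μ` is the common rate in `t`, with `2/ρ` coming from the
  -- squared timer excess. From `(j - 1) Δ ≤ s` follows `μ s ≥ ν (s + j - 1)`. The shift by one
  -- costs `exp ν`, and the square root gives the rate `ν / 2`.
  set κ := max 1 (p' / p * Real.exp ((K + c) * Δ)) with hκ
  set μ := min c (2 / ρ) with hμ
  set ν := μ * Δ / (1 + Δ) with hν
  have hμ0 : 0 < μ := lt_min hc (by positivity)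
  have hν0 : 0 < ν := by positivity
  have hκ1 : 1 ≤ κ := le_max_left _ _
  refine ⟨ν / 2, by positivity, Real.sqrt (κ * Real.exp ν), by positivity,
    fun x hx s j hs => ?_⟩
  obtain ⟨h1, h2, h3, h4⟩ := hmain ρ Δ hΔ hΔρ hρ x hx j s hs
  have hs0 : 0 ≤ s := by
    obtain ⟨j, rfl⟩ | rfl : (∃ i, j = i + 1) ∨ j = 0 := by
      rcases j with _ | j
      exacts [Or.inr rfl, Or.inl ⟨j, rfl⟩]
    · simp at h4
      have : 0 ≤ (j : ℝ) * Δ := by positivity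
      linarith
    · exact x.nonneg_of_mem_dom hs
  have h4' : ((j : ℝ) - 1) * Δ ≤ s := by
    have : (0 : ℝ) ≤ if j = 0 then 0 else (x.val s j).snd := by split_ifs <;> simp [h1]
    linarith
  have hinit := syncLoop_snd_nonneg_of_mem_closure hΔ hx.init
  have hz : ‖(x.val s j).fst‖ ^ 2 ≤ κ * Real.exp (-μ * s) * ‖(x.val 0 0).fst‖ ^ 2 := by
    have h5 := (hVb (x.val s j).fst).1.trans h2
    have h6 := (hVb (x.val 0 0).fst).2
    have h7 : ‖(x.val s j).fst‖ ^ 2 ≤ (Real.exp ((K + c) * Δ) * Real.exp (-c * s) *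
        (p' * ‖(x.val 0 0).fst‖ ^ 2)) / p := by
      rw [le_div_iff₀ hp, mul_comm]
      exact h5.trans (by gcongr)
    calc _ ≤ _ := h7
      _ = (p' / p * Real.exp ((K + c) * Δ)) * Real.exp (-c * s) * ‖(x.val 0 0).fst‖ ^ 2 := by
        field_simp
      _ ≤ _ := by
        gcongr
        · exact le_max_right _ _
        · exact min_le_left _ _
  have hd : max 0 ((x.val s j).snd - 2 * ρ) ^ 2 ≤
      κ * Real.exp (-μ * s) * max 0 ((x.val 0 0).snd - 2 * ρ) ^ 2 := by
    calc _ ≤ (Real.exp (-(1 / ρ) * s) * max 0 ((x.val 0 0).snd - 2 * ρ)) ^ 2 := by gcongr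
      _ = 1 * Real.exp (-(2 / ρ) * s) * max 0 ((x.val 0 0).snd - 2 * ρ) ^ 2 := by
        rw [mul_pow, ← Real.exp_nat_mul, one_mul]; congr 2; push_cast; ring
      _ ≤ _ := by
        gcongr
        exact min_le_right _ _
  have hexp : Real.exp (-μ * s) ≤ Real.exp ν * Real.exp (-(ν / 2) * (s + j)) ^ 2 := by
    rw [← Real.exp_nat_mul, ← Real.exp_add, Real.exp_le_exp]
    push_cast
    have h5 : ν * (1 + Δ) = μ * Δ := by rw [hν]; field_simp
    have h6 : ν * Δ * (s + j - 1) ≤ μ * s * Δ := by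
      calc ν * Δ * (s + j - 1) = ν * (Δ * s + (j - 1) * Δ) := by ring
        _ ≤ ν * (Δ * s + s) := by gcongr
        _ = ν * (1 + Δ) * s := by ring
        _ = _ := by rw [h5]; ring
    have h7 : ν * (s + j - 1) ≤ μ * s := by
      refine le_of_mul_le_mul_right ?_ hΔ
      linarith
    linarith
  refine le_of_sq_le_sq ?_ (mul_nonneg (by positivity)
    Metric.infDist_nonneg)
  rw [mul_pow, mul_pow, Real.sq_sqrt (by positivity), infDist_targetSet_sq hρ0 h1,
    infDist_targetSet_sq hρ0 hinit]
  calc _ ≤ κ * Real.exp (-μ * s) * (‖(x.val 0 0).fst‖ ^ 2 +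
        max 0 ((x.val 0 0).snd - 2 * ρ) ^ 2) := by rw [mul_add]; exact add_le_add hz hd
    _ ≤ κ * (Real.exp ν * Real.exp (-(ν / 2) * (s + j)) ^ 2) * (‖(x.val 0 0).fst‖ ^ 2 +
        max 0 ((x.val 0 0).snd - 2 * ρ) ^ 2) := by gcongr
    _ = _ := by ring

end Apriori

/-! ### From exponential stability to the other stability notions -/

theorem HybridArc.nonneg_time {E : Type*} [PseudoMetricSpace E] (x : HybridArc E) {j : ℕ} :
    ∀ {s : ℝ}, (s, j) ∈ x.dom → 0 ≤ s := by
  induction j with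
  | zero => exact fun hs => x.nonneg_of_mem_dom hs
  | succ j ih =>
    intro s hs
    obtain ⟨a, has, ha, -⟩ := x.exists_jump_time hs
    exact (ih ha).trans has

namespace HybridSystem

variable {E : Type*} [NormedAddCommGroup E] [NormedSpace ℝ E] {H : HybridSystem E} {𝒜 : Set E}

theorem IsExpStable.exists_bound (h : H.IsExpStable 𝒜) :
    ∃ k > 0, ∀ x, H.IsSolution x → ∀ t j, (t, j) ∈ x.dom →
      Metric.infDist (x.val t j) 𝒜 ≤ k * Metric.infDist (x.val 0 0) 𝒜 := by
  obtain ⟨γ, hγ, k, hk, hb⟩ := h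
  refine ⟨k, hk, fun x hx t j hj => (hb x hx t j hj).trans ?_⟩
  have ht := x.nonneg_time hj
  have h1 : Real.exp (-γ * (t + j)) ≤ 1 := by
    rw [Real.exp_le_one_iff]
    have : 0 ≤ γ * (t + j) := by positivity
    linarith
  refine mul_le_mul_of_nonneg_right ?_ Metric.infDist_nonneg
  exact mul_le_of_le_one_right hk.le h1

theorem IsExpStable.isStable (h : H.IsExpStable 𝒜) : H.IsStable 𝒜 := by
  obtain ⟨k, hk, hb⟩ := h.exists_bound
  refine fun ε hε => ⟨ε / k, by positivity, fun x hx h0 t j hj => (hb x hx t j hj).trans ?_⟩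
  calc _ ≤ k * (ε / k) := by gcongr
    _ = ε := by field_simp

theorem IsExpStable.isBounded (h : H.IsExpStable 𝒜) (hc : IsCompact 𝒜) (hne : 𝒜.Nonempty)
    {x : HybridArc E} (hx : H.IsSolution x) : x.IsBounded := by
  obtain ⟨k, hk, hb⟩ := h.exists_bound
  obtain ⟨R, hR⟩ := hc.isBounded.subset_closedBall 0
  refine (Metric.isBounded_closedBall (x := (0 : E))
    (r := k * Metric.infDist (x.val 0 0) 𝒜 + R)).subset ?_
  rintro v ⟨t, j, hj, rfl⟩
  obtain ⟨y, hy, hd⟩ := hc.exists_infDist_eq_dist hne (x.val t j)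
  have h1 := hb x hx t j hj
  rw [hd] at h1
  exact (dist_triangle _ y 0).trans (add_le_add h1 (hR hy))

theorem IsExpStable.convergesTo (h : H.IsExpStable 𝒜) {x : HybridArc E} (hx : H.IsSolution x) :
    x.ConvergesTo 𝒜 := by
  obtain ⟨γ, hγ, k, hk, hb⟩ := h
  intro ε hε
  have hlim : Tendsto (fun r : ℝ => k * Real.exp (-γ * r) * Metric.infDist (x.val 0 0) 𝒜)
      atTop (𝓝 (k * 0 * Metric.infDist (x.val 0 0) 𝒜)) := by
    refine ((Real.tendsto_exp_atBot.comp ?_).const_mul k).mul_const _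
    exact tendsto_id.const_mul_atTop_of_neg (by linarith)
  rw [mul_zero, zero_mul] at hlim
  obtain ⟨N, hN⟩ := eventually_atTop.1 (hlim.eventually (gt_mem_nhds hε))
  exact ⟨N, fun t j hj hNt => (hb x hx t j hj).trans (hN _ hNt).le⟩

theorem IsExpStable.basin_eq_univ (h : H.IsExpStable 𝒜) (hc : IsCompact 𝒜)
    (hne : 𝒜.Nonempty) : H.basin 𝒜 = univ :=
  eq_univ_of_forall fun _ _ hx _ => ⟨h.isBounded hc hne hx, fun _ => h.convergesTo hx⟩

/-- The flow map is bounded on a ball containing the values of the solution. The resulting Lipschitz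
bound gives a limit at a missing right endpoint. -/
theorem IsSolution.exists_lipschitzOnWith [ProperSpace E] [CompleteSpace E] {x : HybridArc E}
    (hx : H.IsSolution x) {f : E → E} (hf : Continuous f) (hF : ∀ ξ, H.F ξ = {f ξ})
    (hb : x.IsBounded) : ∃ K, ∀ j, LipschitzOnWith K (fun s => x.val s j) (x.slice j) := by
  obtain ⟨R, hR⟩ := hb.subset_closedBall 0
  obtain ⟨K, hK⟩ := (isCompact_closedBall (0 : E) R).exists_bound_of_continuousOn hf.continuousOn
  refine ⟨K.toNNReal, fun j => LipschitzOnWith.of_dist_le_mul fun s hs r hr => ?_⟩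
  wlog hsr : s ≤ r generalizing s r
  · rw [dist_comm, dist_comm s]; exact this r hr s hs (le_of_not_ge hsr)
  rcases hsr.eq_or_lt with rfl | hlt
  · simp
  have hsub : Icc s r ⊆ x.slice j := (x.slice_ordConnected j).out hs hr
  refine ((convex_Icc s r).lipschitzOnWith_of_nnnorm_hasDerivWithin_le
    (hx.hasDerivWithinAt hf hF hlt hsub).1 fun t ht => ?_).dist_le_mul s ⟨le_rfl, hsr⟩ r
      ⟨hsr, le_rfl⟩
  rw [← NNReal.coe_le_coe, coe_nnnorm]
  exact (hK _ (hR ⟨t, j, hsub ht, rfl⟩)).trans (Real.le_coe_toNNReal K)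

end HybridSystem

theorem lipschitzOnWith_ite {E : Type*} [PseudoMetricSpace E] {u v : ℝ → E} {K L : NNReal}
    {a b c : ℝ} (hab : a ≤ b) (hbc : b ≤ c) (hu : LipschitzOnWith K u (Icc a b))
    (hv : LipschitzOnWith L v (Icc b c)) (huv : u b = v b) :
    LipschitzOnWith (max K L) (fun s => if s ≤ b then u s else v s) (Icc a c) := by
  refine LipschitzOnWith.of_dist_le_mul fun s hs r hr => ?_
  wlog hsr : s ≤ r generalizing s r
  · rw [dist_comm, dist_comm s]; exact this r hr s hs (le_of_not_ge hsr)
  have hKM : (K : ℝ) ≤ (max K L : NNReal) := by exact_mod_cast le_max_left K L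
  have hLM : (L : ℝ) ≤ (max K L : NNReal) := by exact_mod_cast le_max_right K L
  by_cases h1 : r ≤ b
  · simp only [h1, hsr.trans h1, if_true]
    exact (hu.dist_le_mul s ⟨hs.1, hsr.trans h1⟩ r ⟨hr.1, h1⟩).trans (by gcongr)
  · by_cases h2 : s ≤ b
    · simp only [h1, h2, if_true, if_false]
      have h3 := hu.dist_le_mul s ⟨hs.1, h2⟩ b ⟨hab, le_rfl⟩
      have h4 := hv.dist_le_mul b ⟨le_rfl, hbc⟩ r ⟨(not_le.1 h1).le, hr.2⟩
      rw [Real.dist_eq, abs_of_nonpos (by linarith)] at h3 h4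
      rw [Real.dist_eq s r, abs_of_nonpos (by linarith)]
      have h5 := dist_triangle (u s) (u b) (v r)
      rw [huv] at h5 h3
      have h6 : (K : ℝ) * -(s - b) ≤ (max K L : NNReal) * -(s - b) := by
        gcongr; linarith
      have h7 : (L : ℝ) * -(b - r) ≤ (max K L : NNReal) * -(b - r) := by
        gcongr; linarith
      linarith
    · simp only [h1, h2, if_false]
      exact (hv.dist_le_mul s ⟨(not_le.1 h2).le, hs.2⟩ r ⟨(not_le.1 h1).le, hr.2⟩).trans
        (by gcongr)

/-! ### Local existence of flows -/

/-- Below `ρ` the slope is one. From `ρ` on the equation is `τ' = 2 - τ/ρ`, whose explicit solution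
relaxes to `2ρ` without falling below `ρ`. -/
theorem exists_timer {ρ τ₀ : ℝ} (hρ : 0 < ρ) (h0 : 0 ≤ τ₀) :
    ∃ τ τ' : ℝ → ℝ, τ 0 = τ₀ ∧ (∀ s, HasDerivAt τ (τ' s) s) ∧ Continuous τ' ∧
      ∃ δ > 0, ∀ s ∈ Ico 0 δ, τ' s = 1 - deadzone (τ s / ρ) ∧ 0 ≤ τ s := by
  rcases lt_or_ge τ₀ ρ with h | h
  · refine ⟨fun s => τ₀ + s, fun _ => 1, by simp, fun s => (hasDerivAt_id s).const_add _,
      continuous_const, ρ - τ₀, by linarith, fun s hs => ?_⟩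
    have h1 : 0 ≤ τ₀ + s := by linarith [hs.1]
    refine ⟨?_, h1⟩
    rw [deadzone_of_mem (by positivity) (by rw [div_le_one hρ]; linarith [hs.2]), sub_zero]
  · refine ⟨fun s => 2 * ρ + (τ₀ - 2 * ρ) * Real.exp (-(1 / ρ) * s),
      fun s => (τ₀ - 2 * ρ) * (Real.exp (-(1 / ρ) * s) * (-(1 / ρ) * 1)), by simp, fun s => ?_,
      by fun_prop, 1, one_pos, fun s hs => ?_⟩
    · exact ((((hasDerivAt_id s).const_mul (-(1 / ρ))).exp).const_mul _).const_add _
    · have he0 := Real.exp_pos (-(1 / ρ) * s)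
      have he1 : Real.exp (-(1 / ρ) * s) ≤ 1 := by
        rw [Real.exp_le_one_iff]
        have : 0 ≤ 1 / ρ * s := mul_nonneg (by positivity) hs.1
        linarith
      have hle : ρ ≤ 2 * ρ + (τ₀ - 2 * ρ) * Real.exp (-(1 / ρ) * s) := by nlinarith
      refine ⟨?_, hρ.le.trans hle⟩
      rw [deadzone_of_one_le (by rwa [one_le_div hρ])]
      field_simp
      ring

section Existence

variable {n q : ℕ} {A : Matrix (Fin n) (Fin n) ℝ} {B : Matrix (Fin n) (Fin q) ℝ}
  {C : Matrix (Fin q) (Fin n) ℝ} {Cbar Dbar : Set (Pair n q)} {Δ ρ : ℝ}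

/-- Outside the jump set either `τ < Δ` or the pair lies in the open complement of `Dbar`. Both
conditions persist for a short time along the explicit flow, and each implies membership in the flow
set. -/
theorem syncLoop_exists_local_flow (hΔ : 0 < Δ) (hρ : 0 < ρ) (hD : IsClosed Dbar)
    (hCD : Dbarᶜ ⊆ Cbar) {ξ : State n q} (hξ : 0 ≤ ξ.snd)
    (hξD : ξ ∉ (syncLoop A B C Cbar Dbar Δ ρ).D) :
    ∃ δ > 0, ∃ (w : ℝ → State n q) (K : NNReal), w 0 = ξ ∧ LipschitzOnWith K w (Icc 0 δ) ∧
      ∀ s ∈ Ico 0 δ, HasDerivAt w (flowField A B C ρ (w s)) s ∧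
        w s ∈ (syncLoop A B C Cbar Dbar Δ ρ).C := by
  obtain ⟨τ, τ', hτ0, hτ, hτ'c, δ₀, hδ₀, hτδ⟩ := exists_timer hρ hξ
  set F := errorCLM A B C with hF
  set z : ℝ → Pair n q := fun s => NormedSpace.exp (s • F) ξ.fst with hz
  have hz0 : z 0 = ξ.fst := by
    have h : (0 : ℝ) • F = 0 := zero_smul ℝ F
    simp only [hz, h, NormedSpace.exp_zero]
    rfl
  have hzd : ∀ s, HasDerivAt z (F (z s)) s := fun s => by
    have h := (hasDerivAt_exp_smul_const' (𝕂 := ℝ) F s).clm_apply (hasDerivAt_const s ξ.fst)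
    simpa [hz] using h
  have hzc : Continuous z := continuous_iff_continuousAt.2 fun s => (hzd s).continuousAt
  have hτc : Continuous τ := continuous_iff_continuousAt.2 fun s => (hτ s).continuousAt
  set w : ℝ → State n q := fun s => WithLp.toLp 2 (z s, τ s) with hw
  have hwd : ∀ s, HasDerivAt w (WithLp.toLp 2 (F (z s), τ' s)) s := fun s =>
    hasDerivAt_toLp (hzd s) (hτ s)
  have hev : ∀ᶠ s in 𝓝 (0 : ℝ), τ s < Δ ∨ (z s ∉ Dbar ∧ 0 < τ s) := by
    by_cases h : ξ.snd < Δ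
    · have : ∀ᶠ s in 𝓝 (0 : ℝ), τ s < Δ :=
        hτc.continuousAt.eventually (gt_mem_nhds (by rwa [hτ0]))
      exact this.mono fun s hs => Or.inl hs
    · rw [not_lt] at h
      have h1 : ξ.fst ∉ Dbar := fun hh => hξD ⟨hh, h⟩
      have h2 : ∀ᶠ s in 𝓝 (0 : ℝ), z s ∈ Dbarᶜ :=
        hzc.continuousAt.eventually (hD.isOpen_compl.mem_nhds (by rwa [hz0]))
      have h3 : ∀ᶠ s in 𝓝 (0 : ℝ), 0 < τ s :=
        hτc.continuousAt.eventually (lt_mem_nhds (by rw [hτ0]; linarith))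
      exact (h2.and h3).mono fun s hs => Or.inr hs
  obtain ⟨δ₁, hδ₁, hball⟩ := Metric.eventually_nhds_iff.1 hev
  have hwc : Continuous fun s => (WithLp.toLp 2 (F (z s), τ' s) : State n q) :=
    (WithLp.prod_continuous_toLp 2 (Pair n q) ℝ).comp
      ((F.continuous.comp hzc).prodMk hτ'c)
  obtain ⟨K, hK⟩ := (isCompact_Icc (a := (0 : ℝ)) (b := min δ₀ δ₁)).exists_bound_of_continuousOn
    hwc.continuousOn
  refine ⟨min δ₀ δ₁, lt_min hδ₀ hδ₁, w, K.toNNReal, ?_, ?_, fun s hs => ?_⟩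
  · simp only [hw, hz0, hτ0]; rfl
  · refine (convex_Icc _ _).lipschitzOnWith_of_nnnorm_hasDerivWithin_le
      (fun t _ => (hwd t).hasDerivWithinAt) fun t ht => ?_
    rw [← NNReal.coe_le_coe, coe_nnnorm]
    exact (hK t ht).trans (Real.le_coe_toNNReal K)
  · obtain ⟨h1, h2⟩ := hτδ s ⟨hs.1, hs.2.trans_le (min_le_left _ _)⟩
    refine ⟨?_, h2, ?_⟩
    · have := hwd s
      rwa [h1] at this
    · have h3 : dist s 0 < δ₁ := by
        rw [Real.dist_eq, sub_zero, abs_of_nonneg hs.1]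
        exact hs.2.trans_le (min_le_right _ _)
      rcases hball h3 with h | h
      · exact Or.inr h.le
      · exact Or.inl (hCD h.1)

theorem syncLoop_isClosed_flowSet (hC : IsClosed Cbar) :
    IsClosed (syncLoop A B C Cbar Dbar Δ ρ).C := by
  have h1 : IsClosed {X : State n q | 0 ≤ X.snd} := isClosed_le continuous_const continuous_snd
  have h2 : IsClosed {X : State n q | X.fst ∈ Cbar} := hC.preimage continuous_fst
  have h3 : IsClosed {X : State n q | X.snd ≤ Δ} := isClosed_le continuous_snd continuous_const
  exact h1.inter (h2.union h3)

/-- Were the domain bounded, the last interval would be closed or half-open. A closed one is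
extended by a jump if the final state is in the jump set and by a flow otherwise, and a half-open
one by adding its endpoint. -/
theorem syncLoop_isComplete (hΔ : 0 < Δ) (hρ : 0 < ρ) (hC : IsClosed Cbar) (hD : IsClosed Dbar)
    (hCD : Dbarᶜ ⊆ Cbar) {x : HybridArc (State n q)} (hb : x.IsBounded)
    (hmax : (syncLoop A B C Cbar Dbar Δ ρ).IsMaximalSolution x) : x.IsComplete := by
  by_contra hinc
  obtain ⟨t, J, I, T, h0, hm, hI, hdom⟩ := x.exists_last_interval hinc
  have hx := hmax.1
  have hslice : x.slice J = I := by
    ext s; simp [HybridArc.slice, hdom]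
  have hFcont := continuous_flowField (A := A) (B := B) (C := C) (ρ := ρ)
  have hFeq : ∀ ξ, (syncLoop A B C Cbar Dbar Δ ρ).F ξ = {flowField A B C ρ ξ} := fun _ => rfl
  obtain ⟨K, hK⟩ := hx.exists_lipschitzOnWith hFcont hFeq hb
  have hKJ := hK J
  rw [hslice] at hKJ
  have hderiv : ∀ a b, a < b → Icc a b ⊆ I → ∀ s ∈ Ioo a b,
      HasDerivAt (fun s => x.val s J) (flowField A B C ρ (x.val s J)) s := fun a b hab hsub s hs =>
    ((hx.hasDerivWithinAt hFcont hFeq hab (hslice ▸ hsub)).1 s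
      (Ioo_subset_Icc_self hs)).hasDerivAt (Icc_mem_nhds hs.1 hs.2)
  have hflow : ∀ a b, a < b → Icc a b ⊆ I → ∀ s ∈ Ico a b,
      x.val s J ∈ (syncLoop A B C Cbar Dbar Δ ρ).C := fun a b hab hsub =>
    (hx.hasDerivWithinAt hFcont hFeq hab (hslice ▸ hsub)).2
  rcases hI with ⟨hT, rfl⟩ | ⟨hT, rfl⟩
  · have hmem : (T, J) ∈ x.dom := by rw [hdom]; exact Or.inr ⟨rfl, hT, le_rfl⟩
    have hclosed := syncLoop_isClosed_flowSet (A := A) (B := B) (C := C) (Dbar := Dbar) (Δ := Δ)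
      (ρ := ρ) hC
    -- The final state is the initial one, or a fresh post-jump state with zero timer, or a limit of
    -- states in the closed flow set.
    have hξ : x.val T J ∈ (syncLoop A B C Cbar Dbar Δ ρ).C ∪ (syncLoop A B C Cbar Dbar Δ ρ).D := by
      rcases hT.eq_or_lt with hT' | hT'
      · rcases J with _ | k
        · rw [← hT', h0]
          simpa [hclosed.closure_eq] using hx.init
        · obtain ⟨a, haT, ha1, ha2⟩ := x.exists_jump_time hmem
          have haI : a ∈ Icc (t (k + 1)) T := by rw [← hslice]; exact ha2
          have : a = T := le_antisymm haT (hT' ▸ haI.1)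
          subst this
          have hG : x.val a (k + 1) = WithLp.toLp 2 ((x.val a k).fst.reset, 0) :=
            (hx.jump a k ha1 ha2).2
          have hsnd : (x.val a (k + 1)).snd = 0 := congrArg WithLp.snd hG
          exact Or.inl ⟨hsnd.ge, Or.inr (by rw [hsnd]; exact hΔ.le)⟩
      · left
        have hcl := closure_Ico hT'.ne
        have hTm : T ∈ closure (Ico (t J) T) := by rw [hcl]; exact ⟨hT, le_rfl⟩
        have hcont : ContinuousWithinAt (fun s => x.val s J) (Ico (t J) T) T :=
          (hKJ.continuousOn T ⟨hT, le_rfl⟩).mono Ico_subset_Icc_self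
        exact hclosed.closure_subset (hcont.mem_closure hTm (hflow (t J) T hT' subset_rfl))
    by_cases hξD : x.val T J ∈ (syncLoop A B C Cbar Dbar Δ ρ).D
    · exact hx.not_isMaximal_of_jump h0 hm hT hdom hξD rfl hmax
    · obtain ⟨δ, hδ, w, L, hw0, hwL, hw⟩ := syncLoop_exists_local_flow hΔ hρ hD hCD
        (hξ.resolve_right hξD).1 hξD
      have hv : LipschitzOnWith L (fun s => w (s - T)) (Icc T (T + δ)) := by
        refine LipschitzOnWith.of_dist_le_mul fun s hs r hr => ?_
        have := hwL.dist_le_mul (s - T) ⟨by linarith [hs.1], by linarith [hs.2]⟩ (r - T)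
          ⟨by linarith [hr.1], by linarith [hr.2]⟩
        simpa using this
      refine hx.not_isMaximal_of_flow h0 hm (T := T + δ) (by linarith) hdom ⟨le_rfl, hT⟩
        ⟨Icc_subset_Icc_right (by linarith), fun h => ?_⟩
        (lipschitzOnWith_ite hT (by linarith) hKJ hv (by simp [hw0])) (fun s hs => ?_) ?_
        (fun s hs => ?_) hmax
      · have := (h ⟨by linarith, le_rfl⟩ : T + δ ∈ Icc (t J) T).2
        linarith
      · simp [hs.2]
      · have h2 : ∀ᵐ s : ℝ, s ≠ T := by simp [ae_iff]
        filter_upwards [h2] with s hsT hs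
        refine ⟨_, rfl, ?_⟩
        change HasDerivAt _ (flowField A B C ρ _) s
        rcases lt_or_gt_of_ne hsT with h | h
        · have hd := hderiv (t J) T (hs.1.trans h) subset_rfl s ⟨hs.1, h⟩
          simp only [h.le, if_true]
          refine hd.congr_of_eventuallyEq ?_
          filter_upwards [gt_mem_nhds h] with r hr
          simp [hr.le]
        · simp only [h.not_ge, if_false]
          have hd := (hw (s - T) ⟨by linarith, by linarith [hs.2]⟩).1.comp_sub_const s T
          refine hd.congr_of_eventuallyEq ?_
          filter_upwards [lt_mem_nhds h] with r hr
          simp [not_le.2 hr]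
      · by_cases h : s < T
        · simp only [h.le, if_true]
          exact hflow (t J) T (hs.1.trans_lt h) subset_rfl s ⟨hs.1, h⟩
        · have hCs := (hw (s - T) ⟨by linarith, by linarith [hs.2]⟩).2
          rcases (not_lt.1 h).eq_or_lt with rfl | h'
          · simpa [hw0] using hCs
          · simpa [h'.not_ge] using hCs
  -- Here the Lipschitz extension supplies the value at `T`. The flow condition excludes the right
  -- endpoint, so nothing needs checking there.
  · obtain ⟨y, hy, hyx⟩ := hKJ.extend_finite_dimension
    refine hx.not_isMaximal_of_flow h0 hm hT hdom ⟨le_rfl, hT⟩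
      ⟨Ico_subset_Icc_self, fun h => ?_⟩ hy.lipschitzOnWith (fun s hs => (hyx hs).symm)
      (ae_of_all _ fun s hs => ⟨_, rfl, ?_⟩) (fun s hs => ?_) hmax
    · exact lt_irrefl T (h ⟨hT.le, le_rfl⟩ : T ∈ Ico (t J) T).2
    · change HasDerivAt _ (flowField A B C ρ _) s
      have hmid : s < (s + T) / 2 := by linarith [hs.2]
      have hd := hderiv (t J) ((s + T) / 2) (hs.1.trans hmid)
        (fun r hr => ⟨hr.1, by linarith [hr.2, hs.2]⟩) s ⟨hs.1, hmid⟩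
      rw [← hyx (Ioo_subset_Ico_self hs)]
      refine hd.congr_of_eventuallyEq ?_
      filter_upwards [Ioo_mem_nhds hs.1 hs.2] with r hr
      exact (hyx (Ioo_subset_Ico_self hr)).symm
    · rw [← hyx hs]
      have hmid : s < (s + T) / 2 := by linarith [hs.2]
      exact hflow (t J) ((s + T) / 2) (hs.1.trans_lt hmid)
        (fun r hr => ⟨hr.1, by linarith [hr.2, hs.2]⟩) s ⟨hs.1, hmid⟩

end Existence

/-! ### Closedness and covering properties of the flow and jump pairs -/

section Sets

variable {n q : ℕ} {A : Matrix (Fin n) (Fin n) ℝ} {B : Matrix (Fin n) (Fin q) ℝ}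
  {C : Matrix (Fin q) (Fin n) ℝ} {γx γe : ℝ} {P₁ : Matrix (Fin n) (Fin n) ℝ}
  {P₂ : Matrix (Fin q) (Fin q) ℝ}

theorem Pair.continuous_x : Continuous (Pair.x : Pair n q → _) := by
  unfold Pair.x
  exact (PiLp.continuous_toLp 2 _).comp (by fun_prop)

theorem Pair.continuous_e : Continuous (Pair.e : Pair n q → _) := by
  unfold Pair.e
  exact (PiLp.continuous_toLp 2 _).comp (by fun_prop)

theorem isClosed_flowPairs (hP : (blockP P₁ P₂).IsHermitian) :
    IsClosed (flowPairs A B C γx γe P₁ P₂) := by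
  simp only [flowPairs, inner_gradient_eq_lyapRate hP]
  exact (isClosed_le continuous_lyapRate
    (continuous_const.mul (Pair.continuous_x.norm.pow 2))).inter
    (isClosed_le Pair.continuous_e.norm (continuous_const.mul Pair.continuous_x.norm))

theorem isClosed_jumpPairs (hP : (blockP P₁ P₂).IsHermitian) :
    IsClosed (jumpPairs A B C γx γe P₁ P₂) := by
  simp only [jumpPairs, inner_gradient_eq_lyapRate hP]
  exact (isClosed_le (continuous_const.mul (Pair.continuous_x.norm.pow 2))
    continuous_lyapRate).union
    (isClosed_le (continuous_const.mul Pair.continuous_x.norm) Pair.continuous_e.norm)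

theorem compl_jumpPairs_subset :
    (jumpPairs A B C γx γe P₁ P₂)ᶜ ⊆ flowPairs A B C γx γe P₁ P₂ := by
  intro z hz
  simp only [jumpPairs, mem_compl_iff, mem_ofPred_eq, not_or, not_le] at hz
  exact ⟨hz.1.le, hz.2.le⟩

end Sets

end TLazy

theorem theorem1 {n q : ℕ} (A : Matrix (Fin n) (Fin n) ℝ) (B : Matrix (Fin n) (Fin q) ℝ)
    (C : Matrix (Fin q) (Fin n) ℝ) (hS : TLazy.LinearExpStable (A + B * C))
    (γx : ℝ) (Q P₁ : Matrix (Fin n) (Fin n) ℝ) (P₂ : Matrix (Fin q) (Fin q) ℝ)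
    (hS1 : TLazy.CondS1 A B C γx Q P₁ P₂) (γe : ℝ) (hγe : 0 < γe) :
    ∃ ρ₀ > 0, ∀ ρ Δ : ℝ, 0 < Δ → Δ < ρ → ρ < ρ₀ →
      (TLazy.syncLoop A B C (TLazy.flowPairs A B C γx γe P₁ P₂)
        (TLazy.jumpPairs A B C γx γe P₁ P₂) Δ ρ).IsGAS (TLazy.targetSet n q ρ) ∧
      (B.rank = q →
        (TLazy.syncLoop A B C (TLazy.flowPairs A B C γx γe P₁ P₂)
          (TLazy.jumpPairs A B C γx γe P₁ P₂) Δ ρ).IsGES (TLazy.targetSet n q ρ)) := by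
  obtain ⟨ρ₀, hρ₀, hexp⟩ := hS1.exists_isExpStable hγe
  refine ⟨ρ₀, hρ₀, fun ρ Δ hΔ hΔρ hρ => ?_⟩
  have h := hexp ρ Δ hΔ hΔρ hρ
  have hρ0 : 0 < ρ := hΔ.trans hΔρ
  have hP := hS1.P_posDef.isHermitian
  have hc : IsCompact (TLazy.targetSet n q ρ) := TLazy.isCompact_targetSet
  have hne : (TLazy.targetSet n q ρ).Nonempty :=
    ⟨WithLp.toLp 2 (0, 0), rfl, le_rfl, (by positivity : 0 ≤ 2 * ρ)⟩
  have hbasin := h.basin_eq_univ hc hne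
  -- The radius of attraction is arbitrary because the exponential bound is global.
  refine ⟨⟨hc, h.isStable, ⟨fun x hx => ?_, 1, one_pos, fun x hx _ =>
    ⟨h.isBounded hc hne hx, fun _ => h.convergesTo hx⟩⟩, hbasin⟩, fun _ => ⟨hc, h, hbasin⟩⟩
  exact TLazy.syncLoop_isComplete hΔ hρ0 (TLazy.isClosed_flowPairs hP)
    (TLazy.isClosed_jumpPairs hP) TLazy.compl_jumpPairs_subset (h.isBounded hc hne hx.1) hx
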